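/- **Machine.** Fix a finite set $\mathfrak T$ of threads. A *data structure* $D$ consists of a set of methods, an initial finite heap with a root location $\ell_{root}$ (its argument), and for every method a program that performs atomic memory operations: $\mathsf{newRef}$ (bind a fresh location), $\mathsf{casRef}(\ell,old,new)$ and $\mathsf{frzRef}\,\ell$ (add the bound location $\ell$ to the set $F$ of frozen locations). A CAS on a bound location $\ell$ returns $\mathsf{Left}\,H(\ell)$ if $\ell\in F$, returns $\mathsf{Right}\,H(\ell)$ if $\ell\notin F$ and $H(\ell)\neq old$ (in both cases without changing the heap $H$), and otherwise sets $H(\ell):=new$ and returns $\mathsf{Right}\,new$. A read is a CAS with $old=new$, whose $\mathsf{Left}/\mathsf{Right}$ tag is ignored. Each memory operation takes one time step, pure computation takes none, and a method completes with its last memory operation. A schedule $\pi:\mathbb N\to\mathfrak T$ selects the thread that runs at each time; clients may call any methods in any order. With $D$ comes the class of its states (heap, frozen set, methods in progress); it contains the initial state and is closed under steps of the machine. $D$ is *lock-free* if there is $f_D:\mathbb N\to\mathbb N$ such that, for every configuration of $D$ with heap $H$ and every schedule, every execution of $f_D(|H|)$ time steps from it completes at least one (top-level) method. **Ingredients.**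 Let $A$ and $B$ be data structures with the same method names; the methods of $A$ issue no $\mathsf{frzRef}$. Let $\mathtt{freeze}(a)$ be a program that reads and freezes locations of $A$, and $\mathtt{convert}(a,b)$ a program that reads locations of $A$ and works in the address space of the target $b$. Consider all *transition runs*: they start in a state of $A$ with nothing frozen and a fresh initial $B$; then, arbitrarily interleaved, method calls in progress on $A$ continue until they complete or are aborted by an exception, which a non-read CAS on a frozen location raises; each other thread may still begin one such call; threads not inside a call may call $\mathtt{freeze}$ and, when it has completed, $\mathtt{convert}$ on the common target; and once some call of $\mathtt{convert}$ has completed, such threads may also call methods of $B$. Suppose that there are functions $f_{frz},f_{conv}:\mathbb N\to\mathbb N$ such that at every point of every such run, an unfinished call of $\mathtt{freeze}$ (of $\mathtt{convert}$) has taken at most $f_{frz}(|H_A|)$ (at most $f_{conv}(|H_A|)$) steps of its own, where $H_A$ is the current heap of $A$; and that $\mathtt{convert}$ yields a state of $B$: from the first completion of a call of $\mathtt{convert}$ on, the target together with the method calls of $B$ in progress is a state of the data structure $B$. **Hybrid.** The hybrid of $A$ and $B$ has a root reference $r$ pointing (through an immutable cell, so that it can be changed atomically by CAS) to a value $\mathtt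 A\,a$, $\mathtt{AB}\,a\,b$ or $\mathtt B\,b$; initially $\mathtt A\,a$ with $a$ the initial $A$. The address spaces of $A$, of each instance of $B$, and of the hybrid itself are disjoint. Its methods are: * for each method $m$ of $A$ and $B$: read $r$; if $\mathtt A\,a$, run $A$'s $m$ on $a$, where a non-read CAS on a frozen location raises an exception, upon which $\mathtt{transition}$ is run and then $m$ is restarted; if $\mathtt{AB}\,a\,b$, run $\mathtt{transition}$ and restart $m$; if $\mathtt B\,b$, run $B$'s $m$ on $b$; * $\mathtt{transition}$: read $r$; if $\mathtt A\,a$, create a new $B$-structure $b$ (copying $B$'s initial heap) and try to CAS $r$ from the value read to $\mathtt{AB}\,a\,b$; on failure restart $\mathtt{transition}$, on success run $\mathtt{freeze}(a)$, then $\mathtt{convert}(a,b)$, then CAS $r$ from that $\mathtt{AB}\,a\,b$ to $\mathtt B\,b$ and finish, whether or not this CAS succeeds; if $\mathtt{AB}\,a\,b$, run $\mathtt{freeze}(a)$, then $\mathtt{convert}(a,b)$, then CAS $r$ from the value read to $\mathtt B\,b$ and finish likewise; if $\mathtt B\,b$, perform one dummy read and finish. The states of the hybrid are those reachable from its initial state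 under arbitrary schedules and clients. **Theorem (Lock-freedom).** If $A$ and $B$ are lock-free, then the hybrid data structure is lock-free. -/

import Mathlib

/-! ### Shared memory: finite heaps with frozen locations -/

/-- A heap: a finite partial map from locations to values. -/
@[ext] structure Heap (L V : Type) where
  get : L → Option V
  finite_dom : {ℓ | get ℓ ≠ none}.Finite

namespace Heap

variable {L V : Type}

/-- The domain of the heap. -/
def dom (H : Heap L V) : Set L := {ℓ | H.get ℓ ≠ none}

/-- The size `|H|` of the heap: its number of bound locations. -/
noncomputable def size (H : Heap L V) : ℕ := H.dom.ncard

/-- The empty heap. -/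
def empty : Heap L V := ⟨fun _ => none, by simp⟩

open Classical in
/-- The update `H[ℓ ↦ v]`. -/
noncomputable def set (H : Heap L V) (ℓ : L) (v : V) : Heap L V where
  get := Function.update H.get ℓ (some v)
  finite_dom := (H.finite_dom.insert ℓ).subset fun x hx => by
    by_cases h : x = ℓ
    · exact Or.inl h
    · exact Or.inr (by simpa [Function.update_of_ne h] using hx)

/-- The heap with the given finite list of bindings. -/
noncomputable def ofList (l : List (L × V)) : Heap L V :=
  l.foldr (fun b H => H.set b.1 b.2) empty

end Heap

/-- The shared memory: the heap `H` and the set `F` of frozen locations. -/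
structure Mem (L V : Type) where
  heap : Heap L V
  frozen : Set L

/-! ### Programs as trees of memory operations

Pure computation is instantaneous, so a running program is described by what it does next: one
memory operation, together with the residual program for each possible response.  Residual
programs range over an arbitrary type, so every such tree, finite or infinite, is covered. -/

/-- The next memory operation of a program, with continuations in `X`.
* `new s v k`: bind a fresh location of the address range `s` to `v`, and continue with it;
* `cas ℓ old new k`: compare-and-swap; the response is a left value if `ℓ` is frozen;
* `frz ℓ x`: freeze `ℓ`;
* `stuck`: there is no next operation (the pure computation diverges or goes wrong). -/
inductive Act (L V X : Type) where
  | new (s : Set L) (v : V) (k : L → X)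
  | cas (ℓ : L) (old new : V) (k : V ⊕ V → X)
  | frz (ℓ : L) (x : X)
  | stuck

/-- What is left of a program after an operation: a further program, or a returned value. -/
inductive Next (K R : Type) where
  | more (k : K)
  | done (r : R)

/-- One atomic memory operation: `Exec a μ x μ'` says that performing `a` in the memory `μ` can
lead to the continuation `x` and the memory `μ'`.  Operations `cas` and `frz` act on bound
locations only; `cas` leaves the heap unchanged unless it succeeds, and returns the current value
when it fails.  In particular `cas ℓ d d` never changes the heap: it is a read of `ℓ`. -/
inductive Exec {L V X : Type} : Act L V X → Mem L V → X → Mem L V → Prop where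
  | new {s v k H F ℓ} : ℓ ∈ s → H.get ℓ = none →
      Exec (.new s v k) ⟨H, F⟩ (k ℓ) ⟨H.set ℓ v, F⟩
  | casFrozen {ℓ old new k H F v} : H.get ℓ = some v → ℓ ∈ F →
      Exec (.cas ℓ old new k) ⟨H, F⟩ (k (.inl v)) ⟨H, F⟩
  | casFail {ℓ old new k H F v} : H.get ℓ = some v → ℓ ∉ F → v ≠ old →
      Exec (.cas ℓ old new k) ⟨H, F⟩ (k (.inr v)) ⟨H, F⟩
  | casSuccess {ℓ old new k H F} : H.get ℓ = some old → ℓ ∉ F →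
      Exec (.cas ℓ old new k) ⟨H, F⟩ (k (.inr new)) ⟨H.set ℓ new, F⟩
  | frz {ℓ x H F} : ℓ ∈ H.dom →
      Exec (.frz ℓ x) ⟨H, F⟩ x ⟨H, insert ℓ F⟩

/-! ### Data structures and their abstract machine -/

/-- An implementation of the methods `M`, with return values in `R`: types of locations, values
and residual method bodies, an initial heap (given by its finitely many bindings) with a root
location, and for every method its body, a function of the root location.  A method completes
with the memory operation after which its body returns. -/
structure Impl (M R : Type) where
  L : Type
  V : Type
  K : Type
  root : L
  init : List (L × V)
  init_nodup : (init.map Prod.fst).Nodup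
  body : M → L → K
  act : K → Act L V (Next K R)

namespace Impl

variable {M R : Type}

/-- The part of a configuration that determines future behaviour: the memory and the pool, which
maps each thread to the method call it is executing, with the residual body (`none`: the client
is between two method calls). -/
structure State (D : Impl M R) (T : Type) where
  mem : Mem D.L D.V
  pool : T → Option (M × D.K)

/-- A configuration: state, current time, and trace of completed methods with return values. -/
structure Config (D : Impl M R) (T : Type) where
  state : D.State T
  time : ℕ
  trace : List (M × R)

/-- The initial memory. -/
noncomputable def initMem (D : Impl M R) : Mem D.L D.V := ⟨Heap.ofList D.init, ∅⟩

/-- The initial state: initial heap, nothing frozen, no method call in progress. -/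
noncomputable def initState (D : Impl M R) (T : Type) : D.State T := ⟨D.initMem, fun _ => none⟩

open Classical in
/-- A step of the abstract machine under the schedule `π`.  Calling a method is pure and takes no
time; every memory operation takes one unit of time.  Clients are arbitrary: between two method
calls a client may go on to call any method, which accounts for all client programs. -/
inductive Step (D : Impl M R) {T : Type} (π : ℕ → T) : D.Config T → D.Config T → Prop where
  | call {μ P t tr} (m : M) : P (π t) = none →
      Step D π ⟨⟨μ, P⟩, t, tr⟩
        ⟨⟨μ, Function.update P (π t) (some (m, D.body m D.root))⟩, t, tr⟩
  | op {μ μ' P t tr m k k'} : P (π t) = some (m, k) → Exec (D.act k) μ (.more k') μ' →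
      Step D π ⟨⟨μ, P⟩, t, tr⟩
        ⟨⟨μ', Function.update P (π t) (some (m, k'))⟩, t + 1, tr⟩
  | finish {μ μ' P t tr m k r} : P (π t) = some (m, k) → Exec (D.act k) μ (.done r) μ' →
      Step D π ⟨⟨μ, P⟩, t, tr⟩
        ⟨⟨μ', Function.update P (π t) none⟩, t + 1, tr ++ [(m, r)]⟩

/-- The states that occur in executions from the initial state. -/
inductive Reachable (D : Impl M R) (T : Type) : D.State T → Prop where
  | init : Reachable D T (D.initState T)
  | step {π : ℕ → T} {c c' : D.Config T} :
      Reachable D T c.state → D.Step π c c' → Reachable D T c'.state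

end Impl

/-- A data structure used by the threads `T`: an implementation, together with the states that
count as states of the data structure.  These contain the initial state and are preserved by
every step of the machine; the reachable states are the least choice, but larger choices are
allowed (e.g. all heaps that represent the abstract data in another memory layout). -/
structure DataStructure (T M R : Type) extends Impl M R where
  IsState : toImpl.State T → Prop
  isState_init : IsState (toImpl.initState T)
  isState_step : ∀ (π : ℕ → T) (c c' : toImpl.Config T),
    IsState c.state → toImpl.Step π c c' → IsState c'.state

namespace DataStructure

variable {T M R : Type}

/-- Lock-freedom: there is a function `f` of the heap size such that, from every configuration
`c` of the data structure and under every schedule, every execution of exactly `f |H|` time steps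
completes at least one method. -/
def LockFree (D : DataStructure T M R) : Prop :=
  ∃ f : ℕ → ℕ, ∀ c : D.Config T, D.IsState c.state → ∀ (π : ℕ → T) (c' : D.Config T),
    Relation.ReflTransGen (D.Step π) c c' → c'.time = c.time + f c.state.mem.heap.size →
    c.trace.length < c'.trace.length

/-- The methods of the data structure never issue a freeze operation. -/
def FreezeFree (D : DataStructure T M R) : Prop :=
  ∀ k ℓ x, D.act k ≠ .frz ℓ x

end DataStructure

/-! ### Freezable references, `freeze` and `convert` -/

namespace Act

variable {L V X : Type}

open Classical in
/-- The same operation through freezable references, in the exception monad: a proper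
compare-and-swap on a frozen location raises an exception (`none`), and the program never sees
the left response; reads (`cas ℓ d d`) ignore the frozen bit. -/
noncomputable def freezable : Act L V X → Act L V (Option X)
  | .new s v k => .new s v fun ℓ => some (k ℓ)
  | .cas ℓ o n k => .cas ℓ o n fun
      | .inl v => if o = n then some (k (.inr v)) else none
      | .inr v => some (k (.inr v))
  | .frz ℓ x => .frz ℓ (some x)
  | .stuck => .stuck

/-- The operation is a read or a freeze. -/
def ReadsOrFreezes : Act L V X → Prop
  | .new _ _ _ => False
  | .cas _ o n _ => o = n
  | .frz _ _ => True
  | .stuck => True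

end Act

section Transition

variable {T M R : Type}

/-- A function `freeze :: DS_A a -> IO ()`: a program, started with the root of the structure,
that reads and freezes locations of `A`.  It completes with the operation that leads to `none`. -/
structure FreezeFun (A : DataStructure T M R) where
  K : Type
  start : A.L → K
  act : K → Act A.L A.V (Option K)
  readsOrFreezes : ∀ k, (act k).ReadsOrFreezes

/-- The next operation of `convert`: a read in the address space of `A` (the response is a left
value if the location is frozen), or an operation in the address space of the target `B`. -/
inductive ConvertAct (LA VA LB VB X : Type) where
  | readA (ℓ : LA) (k : VA ⊕ VA → X)
  | onB (a : Act LB VB X)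

/-- A function `convert :: DS_A a -> DS_B a -> IO ()`, started with the roots of the source and
of the (freshly created) target.  It completes with the operation that leads to `none`. -/
structure ConvertFun (A B : DataStructure T M R) where
  K : Type
  start : A.L → B.L → K
  act : K → ConvertAct A.L A.V B.L B.V (Option K)

/-! #### The setting in which `freeze` and `convert` run

A transition from `A` to `B` starts in some state of `A`, with nothing frozen and a fresh `B`.
From then on, in an arbitrary interleaving: threads that are inside a method of `A` go on with it
until it completes or raises an exception, and other threads may still begin one such call;
threads may call `freeze` and after its completion `convert`, any number of them concurrently;
and as soon as some call of `convert` has completed, threads may also call methods of `B`. -/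

/-- What a thread is doing during a transition. -/
inductive Role (A B : DataStructure T M R) (F : FreezeFun A) (C : ConvertFun A B) where
  /-- nothing so far; it may still begin a method call on `A` -/
  | pending
  /-- executing a method of `A` -/
  | runA (k : A.K)
  /-- done with `A` -/
  | free
  /-- in a call of `freeze` that has taken `n` steps so far -/
  | freezing (n : ℕ) (k : F.K)
  /-- its call of `freeze` has completed -/
  | frozen
  /-- in a call of `convert` that has taken `n` steps so far -/
  | converting (n : ℕ) (k : C.K)
  /-- executing the method `m` of `B` -/
  | runB (m : M) (k : B.K)

variable {A B : DataStructure T M R} {F : FreezeFun A} {C : ConvertFun A B}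

/-- The state of a transition: the memories of `A` and of `B`, whether some call of `convert` has
completed, and the roles of the threads. -/
structure TransState (A B : DataStructure T M R) (F : FreezeFun A) (C : ConvertFun A B) where
  memA : Mem A.L A.V
  memB : Mem B.L B.V
  converted : Prop
  role : T → Role A B F C

namespace Role

/-- The thread may begin a call of `freeze`, or of a method of `B`. -/
def Available (ρ : Role A B F C) : Prop := ρ = .pending ∨ ρ = .free

/-- The role of a thread when the transition starts. -/
def ofA : Option (M × A.K) → Role A B F C
  | none => .pending
  | some (_, k) => .runA k

/-- The role after an operation of `A`; exceptions end the call. -/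
def afterA : Option (Next A.K R) → Role A B F C
  | some (.more k) => .runA k
  | some (.done _) => .free
  | none => .free

/-- The role after the `n`-th operation of a call of `freeze`. -/
def afterFreeze (n : ℕ) : Option F.K → Role A B F C
  | some k => .freezing n k
  | none => .frozen

/-- The role after the `n`-th operation of a call of `convert`. -/
def afterConvert (n : ℕ) : Option C.K → Role A B F C
  | some k => .converting n k
  | none => .free

/-- The role after an operation of the method `m` of `B`. -/
def afterB (m : M) : Next B.K R → Role A B F C
  | .more k => .runB m k
  | .done _ => .free

/-- The thread as a thread of the machine of `B`. -/
def toB : Role A B F C → Option (M × B.K)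
  | .runB m k => some (m, k)
  | _ => none

end Role

namespace TransState

/-- The start of a transition from the state `σ` of `A`. -/
noncomputable def start (B : DataStructure T M R) (F : FreezeFun A) (C : ConvertFun A B)
    (σ : A.State T) : TransState A B F C :=
  ⟨σ.mem, B.initMem, False, fun τ => Role.ofA (σ.pool τ)⟩

/-- The state of `B` that is contained in a state of a transition. -/
def stateB (s : TransState A B F C) : B.State T := ⟨s.memB, fun τ => (s.role τ).toB⟩

open Classical in
/-- The steps of a transition. -/
inductive Step : TransState A B F C → TransState A B F C → Prop where
  | callA {μ ν c ρ τ} (m : M) : ρ τ = .pending →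
      Step ⟨μ, ν, c, ρ⟩ ⟨μ, ν, c, Function.update ρ τ (.runA (A.body m A.root))⟩
  | opA {μ μ' ν c ρ τ k x} : ρ τ = .runA k → Exec (A.act k).freezable μ x μ' →
      Step ⟨μ, ν, c, ρ⟩ ⟨μ', ν, c, Function.update ρ τ (Role.afterA x)⟩
  | callFreeze {μ ν c ρ τ} : (ρ τ).Available →
      Step ⟨μ, ν, c, ρ⟩ ⟨μ, ν, c, Function.update ρ τ (.freezing 0 (F.start A.root))⟩
  | opFreeze {μ μ' ν c ρ τ n k x} : ρ τ = .freezing n k → Exec (F.act k) μ x μ' →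
      Step ⟨μ, ν, c, ρ⟩ ⟨μ', ν, c, Function.update ρ τ (Role.afterFreeze (n + 1) x)⟩
  | callConvert {μ ν c ρ τ} : ρ τ = .frozen →
      Step ⟨μ, ν, c, ρ⟩
        ⟨μ, ν, c, Function.update ρ τ (.converting 0 (C.start A.root B.root))⟩
  | readConvert {μ ν c ρ τ n k ℓ κ v x} : ρ τ = .converting n k → C.act k = .readA ℓ κ →
      μ.heap.get ℓ = some v → x = κ (if ℓ ∈ μ.frozen then .inl v else .inr v) →
      Step ⟨μ, ν, c, ρ⟩
        ⟨μ, ν, c ∨ x = none, Function.update ρ τ (Role.afterConvert (n + 1) x)⟩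
  | opConvert {μ ν ν' c ρ τ n k a x} : ρ τ = .converting n k → C.act k = .onB a →
      Exec a ν x ν' →
      Step ⟨μ, ν, c, ρ⟩
        ⟨μ, ν', c ∨ x = none, Function.update ρ τ (Role.afterConvert (n + 1) x)⟩
  | callB {μ ν c ρ τ} (m : M) : c → (ρ τ).Available →
      Step ⟨μ, ν, c, ρ⟩ ⟨μ, ν, c, Function.update ρ τ (.runB m (B.body m B.root))⟩
  | opB {μ ν ν' c ρ τ m k x} : ρ τ = .runB m k → Exec (B.act k) ν x ν' →
      Step ⟨μ, ν, c, ρ⟩ ⟨μ, ν', c, Function.update ρ τ (Role.afterB m x)⟩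

/-- `s` occurs in a transition that starts in a state of `A` in which nothing is frozen. -/
def Occurs (s : TransState A B F C) : Prop :=
  ∃ σ : A.State T, A.IsState σ ∧ σ.mem.frozen = ∅ ∧
    Relation.ReflTransGen Step (start B F C σ) s

end TransState

/-- The running time of `freeze` is bounded by a function of the size of the heap of `A`. -/
def FreezeTimeBounded (F : FreezeFun A) (C : ConvertFun A B) : Prop :=
  ∃ f : ℕ → ℕ, ∀ s : TransState A B F C, s.Occurs →
    ∀ τ n k, s.role τ = .freezing n k → n ≤ f s.memA.heap.size

/-- The running time of `convert` is bounded by a function of the size of the heap of `A`. -/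
def ConvertTimeBounded (F : FreezeFun A) (C : ConvertFun A B) : Prop :=
  ∃ f : ℕ → ℕ, ∀ s : TransState A B F C, s.Occurs →
    ∀ τ n k, s.role τ = .converting n k → n ≤ f s.memA.heap.size

/-- `convert` yields a state of `B`: from the first completion of a call of `convert` on, the
target contains a state of the data structure `B`. -/
def ConvertYieldsState (F : FreezeFun A) (C : ConvertFun A B) : Prop :=
  ∀ s : TransState A B F C, s.Occurs → s.converted → B.IsState s.stateB

end Transition

/-! ### The hybrid data structure -/

/-- The state of the hybrid structure, `data State a = A (DS_A a) | AB (DS_A a) (DS_B a) | B (DS_B a)`.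
A `DS_B` is given by the address region `i` that it lives in, and its root in that region. -/
inductive HState (LA LB : Type) where
  | A (a : LA)
  | AB (a : LA) (b : ℕ × LB)
  | B (b : ℕ × LB)

/-- The locations of the hybrid heap: the root; the cells to which the root points (double
indirection); for each instance of `B` a record that reserves its address region; the address
space of `A`; and the address regions of the instances of `B`. -/
inductive HLoc (LA LB : Type) where
  | root
  | cell (p : ℕ)
  | inst (i : ℕ)
  | a (ℓ : LA)
  | b (i : ℕ) (ℓ : LB)

namespace HLoc

variable {LA LB : Type}

def toA : HLoc LA LB → Option LA
  | .a ℓ => some ℓ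
  | _ => none

def toB : HLoc LA LB → Option LB
  | .b _ ℓ => some ℓ
  | _ => none

end HLoc

/-- The values in the hybrid heap: pointers to cells, states, values of `A`, values of `B`, and a
dummy (contents of the records, and argument of reads). -/
inductive HVal (LA VA LB VB : Type) where
  | ptr (p : ℕ)
  | state (s : HState LA LB)
  | a (v : VA)
  | b (v : VB)
  | dummy

namespace HVal

variable {LA VA LB VB : Type}

def toA : HVal LA VA LB VB → Option VA
  | .a v => some v
  | _ => none

def toB : HVal LA VA LB VB → Option VB
  | .b v => some v
  | _ => none

end HVal

namespace Act

variable {L V X L' V' Y : Type}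

/-- An operation carried out in a part of a larger memory; `bad` is the (impossible) continuation
for responses from outside of that part. -/
def embed (iL : L → L') (iV : V → V') (pL : L' → Option L) (pV : V' → Option V)
    (bad : Y) (f : X → Y) : Act L V X → Act L' V' Y
  | .new s v k => .new (iL '' s) (iV v) fun ℓ => ((pL ℓ).map fun ℓ => f (k ℓ)).getD bad
  | .cas ℓ o n k => .cas (iL ℓ) (iV o) (iV n) fun
      | .inl v => ((pV v).map fun v => f (k (.inl v))).getD bad
      | .inr v => ((pV v).map fun v => f (k (.inr v))).getD bad
  | .frz ℓ x => .frz (iL ℓ) (f x)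
  | .stuck => .stuck

end Act

namespace Hybrid

variable {T M R : Type} {A B : DataStructure T M R} {F : FreezeFun A} {C : ConvertFun A B}

/-- The program points of the hybrid methods.  Inside `transition`, the parameter `c` tells what
comes after it: `none` if it was called as a method by the client, and `some m` if it was called
for helping by the method `m`, which then starts over. -/
inductive Point (A B : DataStructure T M R) (F : FreezeFun A) (C : ConvertFun A B) where
  /-- `rw_op`: `state <- readIORef r`, first the root, then the cell `p` it points to -/
  | rwRoot (m : M)
  | rwCell (m : M) (p : ℕ)
  /-- `A a -> handler $ DS_A.rw_op v a` -/
  | inA (m : M) (k : A.K)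
  /-- `B b -> DS_B.rw_op v b` -/
  | inB (m : M) (i : ℕ) (k : B.K)
  /-- `transition`: `tik <- readForCAS m`, again in two steps -/
  | trRoot (c : Option M)
  | trCell (c : Option M) (p : ℕ)
  /-- `b <- DS_B.new`: reserve a region, then copy the initial heap binding by binding -/
  | newInst (c : Option M) (p : ℕ) (a : A.L)
  | newBinding (c : Option M) (p : ℕ) (a : A.L) (i : ℕ) (ℓ : B.L) (v : B.V)
      (rest : List (B.L × B.V))
  /-- `casIORef m tik (AB a b)`: allocate the new cell `q`, then CAS the root -/
  | newAB (c : Option M) (p : ℕ) (a : A.L) (b : ℕ × B.L)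
  | casAB (c : Option M) (p : ℕ) (a : A.L) (b : ℕ × B.L) (q : ℕ)
  /-- `DS_A.freeze a` -/
  | freeze (c : Option M) (p : ℕ) (a : A.L) (b : ℕ × B.L) (k : F.K)
  /-- `convert a b` -/
  | convert (c : Option M) (p : ℕ) (b : ℕ × B.L) (k : C.K)
  /-- `casIORef m tik (B b)`: allocate the new cell `q`, then CAS the root -/
  | newB (c : Option M) (p : ℕ) (b : ℕ × B.L)
  | casB (c : Option M) (p q : ℕ)
  /-- `B _ -> noop m` -/
  | noop (c : Option M)
  /-- run-time type error -/
  | stuck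

/-- The locations of the hybrid built from `A` and `B`. -/
abbrev Loc (A B : DataStructure T M R) : Type := HLoc A.L B.L

/-- The values of the hybrid built from `A` and `B`. -/
abbrev Val (A B : DataStructure T M R) : Type := HVal A.L A.V B.L B.V

/-- Continuations of hybrid methods; `transition` returns no value. -/
abbrev Cont (A B : DataStructure T M R) (F : FreezeFun A) (C : ConvertFun A B) : Type :=
  Next (Point A B F C) (Option R)

/-- A read of the location `ℓ`. -/
def read (ℓ : Loc A B) (k : Val A B → Cont A B F C) : Act (Loc A B) (Val A B) (Cont A B F C) :=
  .cas ℓ .dummy .dummy (Sum.elim k k)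

/-- Allocation of a cell that holds the state `s`. -/
def newCell (s : HState A.L B.L) (k : ℕ → Cont A B F C) :
    Act (Loc A B) (Val A B) (Cont A B F C) :=
  .new (Set.range HLoc.cell) (.state s) fun
    | .cell q => k q
    | _ => .more .stuck

/-- The end of `transition`: return to the client, or restart the method that called it. -/
def endTransition : Option M → Cont A B F C
  | none => .done none
  | some m => .more (.rwRoot m)

/-- The point of `DS_B.new` at which the bindings in the list are still to be copied. -/
def copyB (c : Option M) (p : ℕ) (a : A.L) (i : ℕ) : List (B.L × B.V) → Point A B F C
  | [] => .newAB c p a (i, B.root)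
  | (ℓ, v) :: rest => .newBinding c p a i ℓ v rest

/-- After an operation of the method `m` of `A`: the handler calls `transition` on exceptions. -/
def afterA (m : M) : Option (Next A.K R) → Cont A B F C
  | some (.more k) => .more (.inA m k)
  | some (.done r) => .done (some r)
  | none => .more (.trRoot (some m))

/-- After an operation of the method `m` of `B`. -/
def afterB (m : M) (i : ℕ) : Next B.K R → Cont A B F C
  | .more k => .more (.inB m i k)
  | .done r => .done (some r)

/-- After an operation of `freeze`. -/
def afterFreeze (c : Option M) (p : ℕ) (a : A.L) (b : ℕ × B.L) : Option F.K → Cont A B F C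
  | some k => .more (.freeze c p a b k)
  | none => .more (.convert c p b (C.start a b.2))

/-- After an operation of `convert`. -/
def afterConvert (c : Option M) (p : ℕ) (b : ℕ × B.L) : Option C.K → Cont A B F C
  | some k => .more (.convert c p b k)
  | none => .more (.newB c p b)

/-- An operation of `A`, in the address space of `A`. -/
def onA {X : Type} (f : X → Cont A B F C) :
    Act A.L A.V X → Act (Loc A B) (Val A B) (Cont A B F C) :=
  Act.embed HLoc.a HVal.a HLoc.toA HVal.toA (.more .stuck) f

/-- An operation of `B`, in the `i`-th address region of `B`. -/
def onB {X : Type} (i : ℕ) (f : X → Cont A B F C) :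
    Act B.L B.V X → Act (Loc A B) (Val A B) (Cont A B F C) :=
  Act.embed (HLoc.b i) HVal.b HLoc.toB HVal.toB (.more .stuck) f

/-- An operation of `convert`. -/
def onConvert {X : Type} (i : ℕ) (f : X → Cont A B F C) :
    ConvertAct A.L A.V B.L B.V X → Act (Loc A B) (Val A B) (Cont A B F C)
  | .readA ℓ k => .cas (.a ℓ) .dummy .dummy fun
      | .inl (.a v) => f (k (.inl v))
      | .inr (.a v) => f (k (.inr v))
      | _ => .more .stuck
  | .onB a => onB i f a

open Classical in
/-- The code of the hybrid methods and of `transition`, with helping. -/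
noncomputable def act : Point A B F C → Act (Loc A B) (Val A B) (Cont A B F C)
  | .rwRoot m => read .root fun
      | .ptr p => .more (.rwCell m p)
      | _ => .more .stuck
  | .rwCell m p => read (.cell p) fun
      | .state (.A a) => .more (.inA m (A.body m a))
      | .state (.AB _ _) => .more (.trRoot (some m))
      | .state (.B b) => .more (.inB m b.1 (B.body m b.2))
      | _ => .more .stuck
  | .inA m k => onA (afterA m) (A.act k).freezable
  | .inB m i k => onB i (afterB m i) (B.act k)
  | .trRoot c => read .root fun
      | .ptr p => .more (.trCell c p)
      | _ => .more .stuck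
  | .trCell c p => read (.cell p) fun
      | .state (.A a) => .more (.newInst c p a)
      | .state (.AB a b) => .more (.freeze c p a b (F.start a))
      | .state (.B _) => .more (.noop c)
      | _ => .more .stuck
  | .newInst c p a => .new (Set.range HLoc.inst) .dummy fun
      | .inst i => .more (copyB c p a i B.init)
      | _ => .more .stuck
  | .newBinding c p a i ℓ v rest => .new {.b i ℓ} (.b v) fun _ => .more (copyB c p a i rest)
  | .newAB c p a b => newCell (.AB a b) fun q => .more (.casAB c p a b q)
  | .casAB c p a b q => .cas .root (.ptr p) (.ptr q) fun x =>
      if x = .inr (.ptr q) then .more (.freeze c q a b (F.start a)) else .more (.trRoot c)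
  | .freeze c p a b k => onA (afterFreeze c p a b) (F.act k)
  | .convert c p b k => onConvert b.1 (afterConvert c p b) (C.act k)
  | .newB c p b => newCell (.B b) fun q => .more (.casB c p q)
  | .casB c p q => .cas .root (.ptr p) (.ptr q) fun _ => endTransition c
  | .noop c => read .root fun _ => endTransition c
  | .stuck => .stuck

/-- The initial heap of the hybrid: the root points to a cell with the state `A a`, and the initial
heap of `A` is copied into the address space of `A`. -/
def init (A B : DataStructure T M R) : List (Loc A B × Val A B) :=
  (.root, .ptr 0) :: (.cell 0, .state (.A A.root)) :: A.init.map fun x => (.a x.1, .a x.2)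

theorem init_nodup (A B : DataStructure T M R) : ((init A B).map Prod.fst).Nodup := by
  have h : (A.init.map fun x => (HLoc.a x.1 : Loc A B)).Nodup := by
    have := A.init_nodup.map (f := (HLoc.a : A.L → Loc A B)) fun _ _ h => HLoc.a.inj h
    simpa [List.map_map, Function.comp_def] using this
  simpa [init, List.map_map, Function.comp_def] using h

/-- The implementation of the hybrid.  Its methods are those of `A` and `B`, and `transition`
(`none`).  Methods of the hybrid act on its unique root. -/
noncomputable def impl (A B : DataStructure T M R) (F : FreezeFun A) (C : ConvertFun A B) :
    Impl (Option M) (Option R) where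
  L := Loc A B
  V := Val A B
  K := Point A B F C
  root := .root
  init := init A B
  init_nodup := init_nodup A B
  body m _ := m.elim (.trRoot none) .rwRoot
  act := act

end Hybrid

/-- The hybrid data structure built from `A` and `B` with the functions `freeze` and `convert`; its
states are those that occur in executions from its initial state. -/
noncomputable def hybrid {T M R : Type} (A B : DataStructure T M R) (F : FreezeFun A)
    (C : ConvertFun A B) : DataStructure T (Option M) (Option R) where
  toImpl := Hybrid.impl A B F C
  IsState := (Hybrid.impl A B F C).Reachable T
  isState_init := .init
  isState_step _ _ _ h hs := .step h hs

/-!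
In the hybrid, every memory operation is an operation of `A`, an operation of the published
instance of `B`, or an operation of the remaining code, which is that of `freeze`, of `convert` and
of the hybrid itself.  In an execution that completes no method, each kind is bounded by a function
of the size of the initial heap.

* Every reachable state of the hybrid is accompanied by a transition run `s` from `A` to `B`, as in
  the hypotheses on `freeze` and `convert`, and by a state `α` of `A` alone (`Ghost`, `Inv`).  As
  long as the root points to `A a`, the run is the one that would start in `α` now.  It gets under
  way when some thread publishes `AB a b`.  The operations of `A` go on in `α` even then: there the
  locations are not frozen, but reads do not notice, and a call that meets a frozen location is
  aborted in the hybrid and merely never scheduled again in `α`.  So the lock-freedom of `A` bounds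
  the number of operations of `A` throughout (`Ghost.Valid.opA`, `Inv.exec`), and with it the heap
  of `A`, and with it the length of the calls of `freeze` and `convert`.
* The root changes at most twice, from `A a` to `AB a b` to `B b`.  A thread that starts over finds
  the root changed, so each thread performs a bounded number of operations of the remaining code;
  `weight` is an explicit bound, which never increases and decreases with each of these operations.
* The instance of `B` is a state of `B` as soon as it is used, so the lock-freedom of `B` bounds the
  number of successive operations of `B`.  A late `convert` may interfere with them, after which the
  count starts again, but only boundedly often.  The recursion `bound` adds this up
  (`Budget.run_le`).

The lock-freedom of `A` and of `B` is about executions under a schedule, whereas the operations of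
`A` and `B` are scattered over the execution of the hybrid.  `Impl.Run` describes them without a
schedule, and `Impl.Run.exists_schedule` provides one.
-/

/-! ### Heaps and single memory operations -/

namespace Heap

variable {L V : Type}

theorem set_get_self (H : Heap L V) (ℓ : L) (v : V) : (H.set ℓ v).get ℓ = some v := by
  simp [set]

theorem set_get_of_ne (H : Heap L V) {ℓ x : L} (v : V) (h : x ≠ ℓ) :
    (H.set ℓ v).get x = H.get x := by
  classical exact Function.update_of_ne h _ _

theorem set_eq_self {H : Heap L V} {ℓ : L} {v : V} (h : H.get ℓ = some v) : H.set ℓ v = H := by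
  ext1
  simp [set, ← h]

theorem size_set_le (H : Heap L V) (ℓ : L) (v : V) : (H.set ℓ v).size ≤ H.size + 1 := by
  have hsub : (H.set ℓ v).dom ⊆ insert ℓ H.dom := by
    intro x hx
    by_cases h : x = ℓ
    · exact Or.inl h
    · exact Or.inr (by simpa [dom, set_get_of_ne H v h] using hx)
  exact (Set.ncard_le_ncard hsub (H.finite_dom.insert ℓ)).trans (Set.ncard_insert_le _ _)

theorem ofList_cons (b : L × V) (l : List (L × V)) :
    ofList (b :: l) = (ofList l).set b.1 b.2 := rfl

theorem ofList_get_eq_some {l : List (L × V)} (hl : (l.map Prod.fst).Nodup) (ℓ : L) (v : V) :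
    (ofList l).get ℓ = some v ↔ (ℓ, v) ∈ l := by
  induction l with
  | nil => simp [ofList, empty]
  | cons b l ih =>
    obtain ⟨hb, hl⟩ := List.nodup_cons.1 hl
    rw [ofList_cons]
    by_cases h : ℓ = b.1
    · subst h
      rw [set_get_self, List.mem_cons]
      constructor
      · intro h
        exact Or.inl (by rw [← Option.some.inj h])
      · rintro (h | h)
        · rw [← h]
        · exact absurd (List.mem_map_of_mem (f := Prod.fst) h) hb
    · rw [set_get_of_ne _ _ h, ih hl, List.mem_cons, or_iff_right]
      rintro rfl
      exact h rfl

end Heap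

/-- A memory operation binds at most one location. -/
theorem Exec.size_le {L V X : Type} {a : Act L V X} {μ μ' : Mem L V} {x : X}
    (h : Exec a μ x μ') : μ'.heap.size ≤ μ.heap.size + 1 := by
  cases h <;> first | exact Heap.size_set_le _ _ _ | exact Nat.le_succ _

theorem Exec.heap_eq_of_readsOrFreezes {L V X : Type} {a : Act L V X} {μ μ' : Mem L V} {x : X}
    (h : Exec a μ x μ') (ha : a.ReadsOrFreezes) : μ'.heap = μ.heap := by
  cases h with
  | new => exact ha.elim
  | casFrozen => rfl
  | casFail => rfl
  | casSuccess hv =>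
    obtain rfl : _ = _ := ha
    exact Heap.set_eq_self hv
  | frz => rfl

/-- An operation through freezable references either raises an exception, which needs a frozen
location, or acts as the plain operation does in the memory with nothing frozen. -/
theorem Exec.of_freezable {L V X : Type} {a : Act L V X} {μ μ' : Mem L V} {y : Option X}
    (ha : ∀ ℓ x, a ≠ .frz ℓ x) (h : Exec a.freezable μ y μ') :
    μ'.frozen = μ.frozen ∧
      ((y = none ∧ μ' = μ ∧ μ.frozen ≠ ∅) ∨
        ∃ x, y = some x ∧ Exec a ⟨μ.heap, ∅⟩ x ⟨μ'.heap, ∅⟩) := by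
  cases a with
  | new s v k =>
    obtain ⟨hs, hn⟩ := h
    exact ⟨rfl, Or.inr ⟨_, rfl, .new hs hn⟩⟩
  | cas ℓ o n k =>
    cases h with
    | casFrozen hv hℓ =>
      rename_i v
      refine ⟨rfl, ?_⟩
      by_cases hon : o = n
      · refine Or.inr ⟨k (.inr v), by simp [hon], ?_⟩
        subst hon
        by_cases hvo : v = o
        · subst hvo
          have := Exec.casSuccess (new := v) (k := k) hv (Set.notMem_empty ℓ)
          rwa [Heap.set_eq_self hv] at this
        · exact .casFail hv (Set.notMem_empty ℓ) hvo
      · refine Or.inl ⟨by simp [hon], rfl, ?_⟩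
        intro h0
        exact Set.notMem_empty ℓ (h0 ▸ hℓ)
    | casFail hv hℓ hne => exact ⟨rfl, Or.inr ⟨_, rfl, .casFail hv (Set.notMem_empty _) hne⟩⟩
    | casSuccess hv hℓ => exact ⟨rfl, Or.inr ⟨_, rfl, .casSuccess hv (Set.notMem_empty _)⟩⟩
  | frz ℓ x => exact absurd rfl (ha ℓ x)
  | stuck => cases h

/-! ### Schedule-free executions in which no method completes -/

namespace Impl

variable {M R T : Type} {D : Impl M R}

open Classical in
/-- `Run n σ σ'`: an execution from `σ` to `σ'` with `n` memory operations that completes no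
method.  There is no schedule; in particular a thread may call a method ahead of its turn. -/
inductive Run (D : Impl M R) : ℕ → D.State T → D.State T → Prop where
  | refl (σ : D.State T) : Run D 0 σ σ
  | call {n μ P τ σ'} (m : M) : P τ = none →
      Run D n ⟨μ, Function.update P τ (some (m, D.body m D.root))⟩ σ' → Run D n ⟨μ, P⟩ σ'
  | op {n μ μ' P τ m k k' σ'} : P τ = some (m, k) → Exec (D.act k) μ (.more k') μ' →
      Run D n ⟨μ', Function.update P τ (some (m, k'))⟩ σ' → Run D (n + 1) ⟨μ, P⟩ σ'

/-- At most `r` operations can be performed from `σ` before some method completes. -/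
def Bounded (D : Impl M R) (σ : D.State T) (r : ℕ) : Prop :=
  ∀ n σ', D.Run n σ σ' → n ≤ r

theorem Run.trans {a b : ℕ} {σ₁ σ₂ σ₃ : D.State T} (h₁ : D.Run a σ₁ σ₂) (h₂ : D.Run b σ₂ σ₃) :
    D.Run (a + b) σ₁ σ₃ := by
  induction h₁ with
  | refl => simpa using h₂
  | call m hm _ ih => exact .call m hm (ih h₂)
  | op hk he _ ih => rw [Nat.add_right_comm]; exact .op hk he (ih h₂)

theorem Run.size_le {n : ℕ} {σ σ' : D.State T} (h : D.Run n σ σ') :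
    σ'.mem.heap.size ≤ σ.mem.heap.size + n := by
  induction h with
  | refl => exact le_rfl
  | call _ _ _ ih => exact ih
  | op _ he _ ih =>
    have := he.size_le
    dsimp only at ih ⊢
    omega

theorem Bounded.of_run {n r : ℕ} {σ σ' : D.State T} (hσ : D.Bounded σ r) (h : D.Run n σ σ') :
    n ≤ r ∧ D.Bounded σ' (r - n) := by
  refine ⟨hσ _ _ h, fun n' σ'' h' => ?_⟩
  have := hσ _ _ (h.trans h')
  omega

theorem Run.exists_of_le {n k : ℕ} {σ σ' : D.State T} (h : D.Run n σ σ') (hk : k ≤ n) :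
    ∃ σ'', D.Run k σ σ'' := by
  induction h generalizing k with
  | refl => exact ⟨_, by obtain rfl : k = 0 := by omega
                         exact .refl _⟩
  | call m hm _ ih =>
    obtain ⟨σ'', h⟩ := ih hk
    exact ⟨σ'', .call m hm h⟩
  | op hm he _ ih =>
    cases k with
    | zero => exact ⟨_, .refl _⟩
    | succ k =>
      obtain ⟨σ'', h⟩ := ih (Nat.le_of_succ_le_succ hk)
      exact ⟨σ'', .op hm he h⟩

theorem Step.congr_schedule {π π' : ℕ → T} {c c' : D.Config T} (h : D.Step π c c')
    (hπ : π c.time = π' c.time) : D.Step π' c c' := by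
  cases h with
  | call m hm => dsimp only at hπ; rw [hπ] at hm ⊢; exact .call m hm
  | op hm he => dsimp only at hπ; rw [hπ] at hm ⊢; exact .op hm he
  | finish hm he => dsimp only at hπ; rw [hπ] at hm ⊢; exact .finish hm he

theorem Step.time_le {π : ℕ → T} {c c' : D.Config T} (h : D.Step π c c') : c.time ≤ c'.time := by
  cases h <;> simp

theorem exec_congr_schedule {π π' : ℕ → T} {c c' : D.Config T}
    (h : Relation.ReflTransGen (D.Step π) c c') (hπ : ∀ t, c.time ≤ t → π t = π' t) :
    Relation.ReflTransGen (D.Step π') c c' := by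
  induction h using Relation.ReflTransGen.head_induction_on with
  | refl => exact .refl
  | head hs _ ih =>
    exact .head (hs.congr_schedule (hπ _ le_rfl)) (ih fun t ht => hπ t (hs.time_le.trans ht))

/-- Every `Run` is realized by a schedule.  A scheduled thread calls a method only when it has its
turn, so the scheduled execution starts from a state `γ` that may lag behind `σ`: some threads
have not yet made the calls that they have already made in `σ`. -/
theorem Run.exists_schedule [Nonempty T] {n : ℕ} {σ σ' : D.State T} (h : D.Run n σ σ')
    (γ : D.State T) (hmem : γ.mem = σ.mem)
    (hlag : ∀ τ, γ.pool τ = σ.pool τ ∨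
      (γ.pool τ = none ∧ ∃ m, σ.pool τ = some (m, D.body m D.root)))
    (t : ℕ) (tr : List (M × R)) :
    ∃ (π : ℕ → T) (γ' : D.State T),
      Relation.ReflTransGen (D.Step π) ⟨γ, t, tr⟩ ⟨γ', t + n, tr⟩ := by
  classical
  induction h generalizing γ t with
  | refl => exact ⟨fun _ => Classical.arbitrary T, γ, .refl⟩
  | @call n μ P τ σ' m hm _ ih =>
    refine ih γ hmem (fun τ' => ?_) t
    by_cases hτ : τ' = τ
    · subst hτ
      refine Or.inr ⟨?_, m, by simp⟩
      rcases hlag τ' with h | h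
      · rw [h]; exact hm
      · exact h.1
    · simpa [Function.update_of_ne hτ] using hlag τ'
  | @op n μ μ' P τ m k k' σ' hm he _ ih =>
    obtain ⟨ν, Q⟩ := γ
    obtain rfl : ν = μ := hmem
    obtain ⟨π, γ', hγ'⟩ := ih ⟨μ', Function.update Q τ (some (m, k'))⟩ rfl (fun τ' => by
      by_cases hτ : τ' = τ
      · subst hτ; simp
      · simpa [Function.update_of_ne hτ] using hlag τ') (t + 1)
    refine ⟨Function.update π t τ, γ', ?_⟩
    have hrest : Relation.ReflTransGen (D.Step (Function.update π t τ))
        ⟨⟨μ', Function.update Q τ (some (m, k'))⟩, t + 1, tr⟩ ⟨γ', t + (n + 1), tr⟩ := by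
      rw [Nat.add_comm n, ← Nat.add_assoc]
      refine exec_congr_schedule hγ' fun t' ht' => (Function.update_of_ne ?_ _ _).symm
      dsimp only at ht'
      omega
    have hπ : Function.update π t τ t = τ := Function.update_self ..
    rcases hlag τ with h | ⟨h, m', h'⟩
    · have hs : D.Step (Function.update π t τ) ⟨⟨ν, Q⟩, t, tr⟩ _ :=
        .op (by rw [hπ]; exact h.trans hm) he
      rw [hπ] at hs
      exact .head (by convert hs) hrest
    · obtain ⟨rfl, rfl⟩ : m' = m ∧ D.body m' D.root = k := by
        have := h'.symm.trans hm
        simpa using this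
      have hc : D.Step (Function.update π t τ) ⟨⟨ν, Q⟩, t, tr⟩ _ :=
        .call m' (by rw [hπ]; exact h)
      have hs : D.Step (Function.update π t τ)
          ⟨⟨ν, Function.update Q τ (some (m', D.body m' D.root))⟩, t, tr⟩ _ :=
        .op (m := m') (k := D.body m' D.root) (by rw [hπ]; simp) he
      rw [hπ] at hc hs
      rw [Function.update_idem] at hs
      exact .head (by convert hc) (.head (by convert hs) hrest)

/-- An execution either completes a method or is a `Run`. -/
theorem exec_trace_or_run {π : ℕ → T} {c c' : D.Config T}
    (h : Relation.ReflTransGen (D.Step π) c c') :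
    c.trace.length < c'.trace.length ∨
      (c.trace.length = c'.trace.length ∧
        ∃ n, c'.time = c.time + n ∧ D.Run n c.state c'.state) := by
  induction h using Relation.ReflTransGen.head_induction_on with
  | refl => exact Or.inr ⟨rfl, 0, rfl, .refl _⟩
  | head hs _ ih =>
    cases hs with
    | call m hm =>
      exact ih.imp_right fun ⟨hl, n, hn, hr⟩ => ⟨hl, n, hn, .call m hm hr⟩
    | op hm he =>
      refine ih.imp_right fun ⟨hl, n, hn, hr⟩ => ⟨hl, n + 1, ?_, .op hm he hr⟩
      dsimp only at hn ⊢
      omega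
    | finish hm he =>
      left
      have : ∀ (l : List (M × R)) x, (l ++ [x]).length = l.length + 1 := by simp
      rcases ih with h | ⟨h, _⟩ <;> dsimp only at h ⊢ <;> rw [this] at h <;> omega

end Impl

theorem exists_monotone_ge (f : ℕ → ℕ) : ∃ g : ℕ → ℕ, Monotone g ∧ ∀ n, f n ≤ g n := by
  refine ⟨fun n => ∑ k ∈ Finset.range (n + 1), f k, fun a b h => ?_, fun n => ?_⟩
  · exact Finset.sum_le_sum_of_subset (Finset.range_mono (by omega))
  · exact Finset.single_le_sum (f := f) (fun _ _ => Nat.zero_le _) (Finset.self_mem_range_succ n)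

theorem DataStructure.LockFree.exists_bounded {T M R : Type} [Nonempty T]
    {D : DataStructure T M R} (hD : D.LockFree) :
    ∃ g : ℕ → ℕ, Monotone g ∧
      ∀ σ : D.State T, D.IsState σ → ∀ z, σ.mem.heap.size ≤ z → D.Bounded σ (g z) := by
  obtain ⟨f, hf⟩ := hD
  obtain ⟨g, hg, hfg⟩ := exists_monotone_ge f
  refine ⟨g, hg, fun σ hσ z hz n σ' hr => ?_⟩
  by_contra hlt
  have hn : f σ.mem.heap.size ≤ n := by
    have := hfg σ.mem.heap.size
    have := hg hz
    omega
  obtain ⟨σ'', hr'⟩ := hr.exists_of_le hn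
  obtain ⟨π, γ, hγ⟩ := hr'.exists_schedule σ rfl (fun τ => Or.inl rfl) 0 []
  exact lt_irrefl _ (hf ⟨σ, 0, []⟩ hσ π ⟨γ, _, []⟩ hγ rfl)

/-! ### A part of a larger memory -/

/-- Under the embeddings `iL` of locations and `iV` of values, the memory `μ` is a part of the
memory `μ'`. -/
structure Sim {L V L' V' : Type} (iL : L → L') (iV : V → V') (μ' : Mem L' V') (μ : Mem L V) :
    Prop where
  get : ∀ ℓ, μ'.heap.get (iL ℓ) = (μ.heap.get ℓ).map iV
  frozen : ∀ ℓ, iL ℓ ∈ μ'.frozen ↔ ℓ ∈ μ.frozen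

/-- The memories `μ` and `μ'` agree outside of `S`. -/
def Frame {L V : Type} (S : Set L) (μ μ' : Mem L V) : Prop :=
  ∀ ℓ, ℓ ∉ S → μ'.heap.get ℓ = μ.heap.get ℓ ∧ (ℓ ∈ μ'.frozen ↔ ℓ ∈ μ.frozen)

theorem Frame.refl {L V : Type} (S : Set L) (μ : Mem L V) : Frame S μ μ :=
  fun _ _ => ⟨rfl, Iff.rfl⟩

theorem Frame.set {L V : Type} (H : Heap L V) (F : Set L) (ℓ : L) (v : V) :
    Frame {ℓ} ⟨H, F⟩ ⟨H.set ℓ v, F⟩ :=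
  fun _ hx => ⟨Heap.set_get_of_ne H v hx, Iff.rfl⟩

theorem Frame.mono {L V : Type} {S S' : Set L} {μ μ' : Mem L V} (h : Frame S μ μ')
    (hS : S ⊆ S') : Frame S' μ μ' :=
  fun ℓ hℓ => h ℓ fun h' => hℓ (hS h')

theorem Sim.exists_get {L V L' V' : Type} {iL : L → L'} {iV : V → V'} {μ' : Mem L' V'}
    {μ : Mem L V} (h : Sim iL iV μ' μ) {ℓ : L} {v' : V'} (hv : μ'.heap.get (iL ℓ) = some v') :
    ∃ v, μ.heap.get ℓ = some v ∧ v' = iV v := by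
  rw [h.get ℓ] at hv
  obtain ⟨v, hv', rfl⟩ := Option.map_eq_some_iff.1 hv
  exact ⟨v, hv', rfl⟩

theorem Sim.of_frame {L V L' V' : Type} {iL : L → L'} {iV : V → V'} {μ' ν' : Mem L' V'}
    {μ : Mem L V} {S : Set L'} (h : Sim iL iV μ' μ) (hf : Frame S μ' ν')
    (hS : ∀ ℓ, iL ℓ ∉ S) : Sim iL iV ν' μ :=
  ⟨fun ℓ => (hf _ (hS ℓ)).1.trans (h.get ℓ), fun ℓ => (hf _ (hS ℓ)).2.trans (h.frozen ℓ)⟩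

theorem Sim.size_le {L V L' V' : Type} {iL : L → L'} {iV : V → V'} {μ' : Mem L' V'}
    {μ : Mem L V} (h : Sim iL iV μ' μ) (hL : Function.Injective iL) :
    μ.heap.size ≤ μ'.heap.size := by
  refine Set.ncard_le_ncard_of_injOn iL (fun ℓ hℓ => ?_) hL.injOn μ'.heap.finite_dom
  have hℓ : μ.heap.get ℓ ≠ none := hℓ
  simpa [Heap.dom, h.get ℓ] using hℓ

theorem Sim.set {L V L' V' : Type} {iL : L → L'} {iV : V → V'} {H' : Heap L' V'} {F' : Set L'}
    {H : Heap L V} {F : Set L} (h : Sim iL iV ⟨H', F'⟩ ⟨H, F⟩) (hL : Function.Injective iL)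
    (ℓ : L) (v : V) : Sim iL iV ⟨H'.set (iL ℓ) (iV v), F'⟩ ⟨H.set ℓ v, F⟩ := by
  refine ⟨fun x => ?_, h.frozen⟩
  dsimp only
  by_cases hx : x = ℓ
  · subst hx; simp [Heap.set_get_self]
  · rw [Heap.set_get_of_ne _ _ hx, Heap.set_get_of_ne _ _ (hL.ne hx)]
    exact h.get x

/-- An embedded operation acts on the part of the memory as the original one does, and on nothing
else. -/
theorem Exec.of_embed {L V X L' V' Y : Type} {iL : L → L'} {iV : V → V'} {pL : L' → Option L}
    {pV : V' → Option V} {bad : Y} {f : X → Y} {a : Act L V X} {μ' ν' : Mem L' V'} {y : Y}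
    {μ : Mem L V} (hL : ∀ ℓ, pL (iL ℓ) = some ℓ) (hV : ∀ v, pV (iV v) = some v)
    (h : Sim iL iV μ' μ) (he : Exec (a.embed iL iV pL pV bad f) μ' y ν') :
    ∃ x ν, Exec a μ x ν ∧ y = f x ∧ Sim iL iV ν' ν ∧ Frame (Set.range iL) μ' ν' := by
  have hLi : Function.Injective iL := fun a b hab => by simpa [hL] using congrArg pL hab
  have hVi : Function.Injective iV := fun a b hab => by simpa [hV] using congrArg pV hab
  obtain ⟨H, G⟩ := μ
  cases a with
  | new s v k =>
    cases he with
    | new hs hn =>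
      obtain ⟨ℓ, hℓ, rfl⟩ := hs
      have hn' : H.get ℓ = none := by simpa [hn] using (h.get ℓ).symm
      refine ⟨k ℓ, _, .new hℓ hn', by simp [hL], h.set hLi ℓ v, ?_⟩
      exact (Frame.set _ _ _ _).mono (by simp)
  | cas ℓ o n k =>
    cases he with
    | casFrozen hv hℓ =>
      obtain ⟨v, hv', rfl⟩ := h.exists_get hv
      exact ⟨_, _, .casFrozen hv' ((h.frozen ℓ).1 hℓ), by simp [hV], h, Frame.refl _ _⟩
    | casFail hv hℓ hne =>
      obtain ⟨v, hv', rfl⟩ := h.exists_get hv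
      exact ⟨_, _, .casFail hv' (fun h' => hℓ ((h.frozen ℓ).2 h')) fun h' => hne (h' ▸ rfl),
        by simp [hV], h, Frame.refl _ _⟩
    | casSuccess hv hℓ =>
      obtain ⟨v, hv', hv''⟩ := h.exists_get hv
      obtain rfl := hVi hv''
      refine ⟨_, _, .casSuccess hv' (fun h' => hℓ ((h.frozen ℓ).2 h')), by simp [hV],
        h.set hLi ℓ n, ?_⟩
      exact (Frame.set _ _ _ _).mono (by simp)
  | frz ℓ x =>
    cases he with
    | @frz _ _ H' F' hℓ =>
      have hℓ' : ℓ ∈ H.dom := by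
        have hℓ : H'.get (iL ℓ) ≠ none := hℓ
        have := h.get ℓ
        simp only at this
        rw [this] at hℓ
        simpa [Heap.dom] using hℓ
      refine ⟨_, _, .frz hℓ', rfl, ⟨h.get, fun x => ?_⟩, fun x hx => ⟨rfl, ?_⟩⟩
      · have := h.frozen x
        simp only at this
        simp [Set.mem_insert_iff, hLi.eq_iff, this]
      · have : x ≠ iL ℓ := fun h => hx ⟨ℓ, h.symm⟩
        simp [Set.mem_insert_iff, this]
  | stuck => cases he

/-! ### The transition that accompanies an execution of the hybrid -/

namespace Hybrid

variable {T M R : Type} {A B : DataStructure T M R} {F : FreezeFun A} {C : ConvertFun A B}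

/-- How far the hybrid has got, with the cell `q` of the published state `AB a b`, the address
region `i` of `b`, and the cell `q'` of the published state `B b`. -/
inductive Phase where
  | A
  | AB (q i : ℕ)
  | B (q i q' : ℕ)

namespace Phase

/-- The cell and the address region of the published target. -/
def pub : Phase → Option (ℕ × ℕ)
  | .A => none
  | .AB q i => some (q, i)
  | .B q i _ => some (q, i)

/-- The cell of the published state `B b`. -/
def cellB : Phase → Option ℕ
  | .B _ _ q' => some q'
  | _ => none

/-- The cell that the root points to. -/
def rootCell : Phase → ℕ
  | .A => 0
  | .AB q _ => q
  | .B _ _ q' => q'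

/-- Progress of the hybrid. -/
inductive Le : Phase → Phase → Prop where
  | refl (φ) : Le φ φ
  | publish (q i) : Le .A (.AB q i)
  | close (q i q') : Le (.AB q i) (.B q i q')

theorem Le.pub {φ φ' : Phase} (h : φ.Le φ') {x : ℕ × ℕ} (hx : φ.pub = some x) :
    φ'.pub = some x := by
  cases h <;> simp_all [Phase.pub]

theorem Le.cellB {φ φ' : Phase} (h : φ.Le φ') {x : ℕ} (hx : φ.cellB = some x) :
    φ'.cellB = some x := by
  cases h <;> simp_all [Phase.cellB]

/-- `φ.Cell A B p st`: the root points or has pointed to the cell `p`, which holds `st`. -/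
inductive Cell (A B : DataStructure T M R) (φ : Phase) : ℕ → HState A.L B.L → Prop where
  | a : Cell A B φ 0 (.A A.root)
  | ab {q i} : φ.pub = some (q, i) → Cell A B φ q (.AB A.root (i, B.root))
  | b {q i q'} : φ.pub = some (q, i) → φ.cellB = some q' → Cell A B φ q' (.B (i, B.root))

theorem Cell.mono {φ φ' : Phase} (h : φ.Le φ') {p : ℕ} {st : HState A.L B.L}
    (hc : φ.Cell A B p st) : φ'.Cell A B p st := by
  cases hc with
  | a => exact .a
  | ab hp => exact .ab (h.pub hp)
  | b hp hb => exact .b (h.pub hp) (h.cellB hb)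

theorem cell_rootCell (A B : DataStructure T M R) (φ : Phase) :
    ∃ st, φ.Cell A B φ.rootCell st := by
  cases φ with
  | A => exact ⟨_, .a⟩
  | AB q i => exact ⟨_, .ab rfl⟩
  | B q i q' => exact ⟨_, .b rfl rfl⟩

end Phase

/-- What accompanies a state of the hybrid: a state `α` of `A`, a transition `s`, and the phase.
In `α` nothing is frozen; a call on `A` that an exception has aborted stays in progress there
without ever being scheduled again, so `α` is a state that `A` alone can reach. -/
structure Ghost (A B : DataStructure T M R) (F : FreezeFun A) (C : ConvertFun A B) where
  α : A.State T
  s : TransState A B F C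
  φ : Phase

namespace Ghost

/-- The thread is not executing anything on behalf of `A`, `B` or the transition. -/
def Idle (G : Ghost A B F C) (τ : T) : Prop :=
  G.s.role τ = .free ∨ (G.s.role τ = .pending ∧ G.α.pool τ = none)

/-- The part of the invariant that does not mention the hybrid.  As long as nothing has been
published, the transition is the one that would start now. -/
structure Valid (G : Ghost A B F C) : Prop where
  isState : A.IsState G.α
  occurs : G.s.Occurs
  memA : G.α.mem = ⟨G.s.memA.heap, ∅⟩
  start : G.φ = .A → G.s = TransState.start B F C G.α
  converted : ∀ q, G.φ.cellB = some q → G.s.converted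

theorem Idle.available {G : Ghost A B F C} {τ : T} (h : G.Idle τ) : (G.s.role τ).Available :=
  h.elim Or.inr fun h => Or.inl h.1

theorem Valid.pending_of_phaseA {G : Ghost A B F C} (hG : G.Valid) (hφ : G.φ = .A) {τ : T}
    (h : G.Idle τ) : G.s.role τ = .pending ∧ G.α.pool τ = none := by
  refine h.resolve_left fun h' => ?_
  rw [hG.start hφ] at h'
  simp only [TransState.start] at h'
  cases hp : G.α.pool τ <;> simp [hp, Role.ofA] at h'

end Ghost

/-! ### The invariant -/

/-- The invariant of the memory of the hybrid. -/
structure MemInv (G : Ghost A B F C) (μ : Mem (Loc A B) (Val A B)) : Prop where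
  simA : Sim HLoc.a HVal.a μ G.s.memA
  simB : ∀ q i, G.φ.pub = some (q, i) →
    Sim (HLoc.b i) HVal.b μ G.s.memB ∧ μ.heap.get (.inst i) ≠ none
  root : μ.heap.get .root = some (.ptr G.φ.rootCell)
  root_not_frozen : HLoc.root ∉ μ.frozen
  cell : ∀ p st, G.φ.Cell A B p st → μ.heap.get (.cell p) = some (.state st)
  fresh : ∀ i, μ.heap.get (.inst i) = none →
    ∀ ℓ, μ.heap.get (.b i ℓ) = none ∧ HLoc.b i ℓ ∉ μ.frozen

/-- The address region `i` is reserved but not published, and contains exactly the bindings in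
`l`. -/
structure Private (G : Ghost A B F C) (μ : Mem (Loc A B) (Val A B)) (i : ℕ)
    (l : List (B.L × B.V)) : Prop where
  inst : μ.heap.get (.inst i) ≠ none
  not_pub : ∀ q, G.φ.pub ≠ some (q, i)
  get : ∀ ℓ x, μ.heap.get (.b i ℓ) = some x ↔ ∃ v, (ℓ, v) ∈ l ∧ x = .b v
  not_frozen : ∀ ℓ, HLoc.b i ℓ ∉ μ.frozen

/-- The address region that a thread at this point is preparing for publication. -/
def owned : Option (Point A B F C) → Option ℕ
  | some (.newBinding _ _ _ i _ _ _) => some i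
  | some (.newAB _ _ _ b) => some b.1
  | some (.casAB _ _ _ b _) => some b.1
  | _ => none

/-- The invariant of a thread at the given program point (`none`: between two method calls). -/
def ThreadInv (G : Ghost A B F C) (μ : Mem (Loc A B) (Val A B)) (τ : T) :
    Option (Point A B F C) → Prop
  | none => G.Idle τ
  | some (.rwRoot _) => G.Idle τ
  | some (.rwCell _ p) => G.Idle τ ∧ (∃ st, G.φ.Cell A B p st) ∧ (p = 0 → G.s.role τ = .pending)
  | some (.inA m k) => G.s.role τ = .runA k ∧ G.α.pool τ = some (m, k)
  | some (.inB m i k) => G.s.converted ∧ (∃ q, G.φ.pub = some (q, i)) ∧ G.s.role τ = .runB m k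
  | some (.trRoot _) => G.Idle τ
  | some (.trCell _ p) => G.Idle τ ∧ ∃ st, G.φ.Cell A B p st
  | some (.newInst _ p a) => G.Idle τ ∧ p = 0 ∧ a = A.root
  | some (.newBinding _ p a i ℓ v rest) => G.Idle τ ∧ p = 0 ∧ a = A.root ∧
      ∃ dn, B.init = dn ++ (ℓ, v) :: rest ∧ Private G μ i dn
  | some (.newAB _ p a b) =>
      G.Idle τ ∧ p = 0 ∧ a = A.root ∧ b.2 = B.root ∧ Private G μ b.1 B.init
  | some (.casAB _ p a b q) =>
      G.Idle τ ∧ p = 0 ∧ a = A.root ∧ b.2 = B.root ∧ Private G μ b.1 B.init ∧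
        μ.heap.get (.cell q) = some (.state (.AB a b))
  | some (.freeze _ p a b k) => a = A.root ∧ b.2 = B.root ∧ G.φ.pub = some (p, b.1) ∧
      ∃ n, G.s.role τ = .freezing n k
  | some (.convert _ p b k) => b.2 = B.root ∧ G.φ.pub = some (p, b.1) ∧
      ∃ n, G.s.role τ = .converting n k
  | some (.newB _ p b) =>
      G.Idle τ ∧ G.s.converted ∧ b.2 = B.root ∧ G.φ.pub = some (p, b.1)
  | some (.casB _ p q) => G.Idle τ ∧ G.s.converted ∧
      ∃ i, G.φ.pub = some (p, i) ∧ μ.heap.get (.cell q) = some (.state (.B (i, B.root)))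
  | some (.noop _) => G.Idle τ ∧ G.φ.cellB ≠ none
  | some .stuck => False

/-- The invariant of the hybrid with the memory `μ` and the threads at the points `P`. -/
structure Inv (G : Ghost A B F C) (μ : Mem (Loc A B) (Val A B)) (P : T → Option (Point A B F C)) :
    Prop where
  valid : G.Valid
  mem : MemInv G μ
  thread : ∀ τ, ThreadInv G μ τ (P τ)
  owned_ne : ∀ τ τ' i, owned (P τ) = some i → owned (P τ') = some i → τ = τ'

/-- `G.Ext τ G'`: the phase does not fall back, and threads other than `τ` do nothing. -/
structure Ghost.Ext (G : Ghost A B F C) (τ : T) (G' : Ghost A B F C) : Prop where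
  phase : G.φ.Le G'.φ
  converted : G.s.converted → G'.s.converted
  role : ∀ τ', τ' ≠ τ → G'.s.role τ' = G.s.role τ'
  pool : ∀ τ', τ' ≠ τ → G'.α.pool τ' = G.α.pool τ'

theorem Ghost.Ext.refl (G : Ghost A B F C) (τ : T) : G.Ext τ G :=
  ⟨.refl _, id, fun _ _ => rfl, fun _ _ => rfl⟩

theorem Ghost.Ext.idle {G G' : Ghost A B F C} {τ τ' : T} (h : G.Ext τ G') (hτ : τ' ≠ τ)
    (hi : G.Idle τ') : G'.Idle τ' := by
  unfold Ghost.Idle at *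
  rwa [h.role τ' hτ, h.pool τ' hτ]

theorem Private.mono {G G' : Ghost A B F C} {μ μ' : Mem (Loc A B) (Val A B)} {i : ℕ}
    {l : List (B.L × B.V)} (h : Private G μ i l)
    (hinst : μ'.heap.get (.inst i) ≠ none)
    (hpub : ∀ q, G'.φ.pub ≠ some (q, i))
    (hb : ∀ ℓ, μ'.heap.get (.b i ℓ) = μ.heap.get (.b i ℓ) ∧
      (HLoc.b i ℓ ∈ μ'.frozen ↔ HLoc.b i ℓ ∈ μ.frozen)) : Private G' μ' i l :=
  ⟨hinst, hpub, fun ℓ x => by rw [(hb ℓ).1]; exact h.get ℓ x,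
    fun ℓ => by rw [(hb ℓ).2]; exact h.not_frozen ℓ⟩

theorem ThreadInv.owned_private {G : Ghost A B F C} {μ : Mem (Loc A B) (Val A B)} {τ : T}
    {pt : Option (Point A B F C)} (h : ThreadInv G μ τ pt) {i : ℕ} (hi : owned pt = some i) :
    ∃ l, Private G μ i l := by
  rcases pt with _ | pt
  · cases hi
  · cases pt <;> simp only [owned, Option.some.injEq, reduceCtorEq] at hi
    · obtain ⟨_, _, _, dn, _, h⟩ := h
      exact ⟨_, hi ▸ h⟩
    · obtain ⟨_, _, _, _, h⟩ := h
      exact ⟨_, hi ▸ h⟩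
    · obtain ⟨_, _, _, _, h, _⟩ := h
      exact ⟨_, hi ▸ h⟩

/-- The invariant of a thread survives what other threads do: they change neither its role, nor
existing cells, nor its private region. -/
theorem ThreadInv.mono {G G' : Ghost A B F C} {μ μ' : Mem (Loc A B) (Val A B)} {τ τ' : T}
    {pt : Option (Point A B F C)} (h : ThreadInv G μ τ' pt) (hG : G.Ext τ G') (hτ : τ' ≠ τ)
    (hcell : ∀ q x, μ.heap.get (.cell q) = some x → μ'.heap.get (.cell q) = some x)
    (hpriv : ∀ i l, owned pt = some i → Private G μ i l → Private G' μ' i l) :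
    ThreadInv G' μ' τ' pt := by
  rcases pt with _ | pt
  · exact hG.idle hτ h
  · cases pt <;> simp only [ThreadInv, hG.role τ' hτ, hG.pool τ' hτ] at h ⊢
    case rwRoot => exact hG.idle hτ h
    case rwCell =>
      obtain ⟨h, ⟨st, hst⟩, h0⟩ := h
      exact ⟨hG.idle hτ h, ⟨st, hst.mono hG.phase⟩, h0⟩
    case inA => exact h
    case inB =>
      obtain ⟨h, ⟨q, hq⟩, h'⟩ := h
      exact ⟨hG.converted h, ⟨q, hG.phase.pub hq⟩, h'⟩
    case trRoot => exact hG.idle hτ h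
    case trCell =>
      obtain ⟨h, ⟨st, hst⟩⟩ := h
      exact ⟨hG.idle hτ h, ⟨st, hst.mono hG.phase⟩⟩
    case newInst => exact ⟨hG.idle hτ h.1, h.2⟩
    case newBinding =>
      obtain ⟨h, h0, ha, dn, hdn, hp⟩ := h
      exact ⟨hG.idle hτ h, h0, ha, dn, hdn, hpriv _ _ rfl hp⟩
    case newAB =>
      obtain ⟨h, h0, ha, hb, hp⟩ := h
      exact ⟨hG.idle hτ h, h0, ha, hb, hpriv _ _ rfl hp⟩
    case casAB =>
      obtain ⟨h, h0, ha, hb, hp, hq⟩ := h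
      exact ⟨hG.idle hτ h, h0, ha, hb, hpriv _ _ rfl hp, hcell _ _ hq⟩
    case freeze => exact ⟨h.1, h.2.1, hG.phase.pub h.2.2.1, h.2.2.2⟩
    case convert => exact ⟨h.1, hG.phase.pub h.2.1, h.2.2⟩
    case newB => exact ⟨hG.idle hτ h.1, hG.converted h.2.1, h.2.2.1, hG.phase.pub h.2.2.2⟩
    case casB =>
      obtain ⟨h, hc, i, hi, hq⟩ := h
      exact ⟨hG.idle hτ h, hG.converted hc, i, hG.phase.pub hi, hcell _ _ hq⟩
    case noop =>
      obtain ⟨h, hb⟩ := h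
      refine ⟨hG.idle hτ h, ?_⟩
      obtain ⟨x, hx⟩ := Option.ne_none_iff_exists'.1 hb
      simp [hG.phase.cellB hx]

open Classical in
/-- Restoring the invariant after a step of the thread `τ`. -/
theorem Inv.update {G G' : Ghost A B F C} {μ μ' : Mem (Loc A B) (Val A B)} {τ : T}
    {P : T → Option (Point A B F C)} {pt : Option (Point A B F C)} (h : Inv G μ P)
    (hG : G.Ext τ G') (hv : G'.Valid) (hm : MemInv G' μ')
    (hcell : ∀ q x, μ.heap.get (.cell q) = some x → μ'.heap.get (.cell q) = some x)
    (hpriv : ∀ τ' i l, τ' ≠ τ → owned (P τ') = some i → Private G μ i l → Private G' μ' i l)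
    (hpt : ThreadInv G' μ' τ pt)
    (hown : ∀ i τ', owned pt = some i → τ' ≠ τ → owned (P τ') ≠ some i) :
    Inv G' μ' (Function.update P τ pt) := by
  refine ⟨hv, hm, fun τ' => ?_, fun τ₁ τ₂ i h₁ h₂ => ?_⟩
  · by_cases hτ : τ' = τ
    · subst hτ; simpa using hpt
    · rw [Function.update_of_ne hτ]
      exact (h.thread τ').mono hG hτ hcell fun i l => hpriv τ' i l hτ
  · by_cases hτ₁ : τ₁ = τ <;> by_cases hτ₂ : τ₂ = τ
    · exact hτ₁.trans hτ₂.symm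
    · subst hτ₁
      rw [Function.update_self] at h₁
      rw [Function.update_of_ne hτ₂] at h₂
      exact absurd h₂ (hown i τ₂ h₁ hτ₂)
    · subst hτ₂
      rw [Function.update_self] at h₂
      rw [Function.update_of_ne hτ₁] at h₁
      exact absurd h₁ (hown i τ₁ h₂ hτ₁)
    · rw [Function.update_of_ne hτ₁] at h₁
      rw [Function.update_of_ne hτ₂] at h₂
      exact h.owned_ne _ _ i h₁ h₂

/-! ### Weights and progress -/

/-- The number of operations that the current call of `freeze` or `convert` has taken. -/
def stepsTaken : Role A B F C → ℕ
  | .freezing n _ => n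
  | .converting n _ => n
  | _ => 0

/-- A bound on the number of operations, other than those of `A` and of `B`, that a thread at the
given point can perform before it completes its method; calls of `freeze` take at most `s`
operations and calls of `convert` at most `v`.  The point after a failed `casAB` is `trRoot` again,
but then the root has left the state `A a` for good; likewise a method that starts over after
`casB` finds the state `B b`. -/
def weight (s v : ℕ) (φ : Phase) (ρ : Role A B F C) : Option (Point A B F C) → ℕ
  | none => s + v + 13 + B.init.length
  | some (.rwRoot _) => if φ.cellB = none then s + v + 11 else 2
  | some (.rwCell _ p) => if φ.cellB = some p then 1 else s + v + 10
  | some (.inA _ _) => s + v + 9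
  | some (.inB _ _ _) => 0
  | some (.trRoot _) => if φ.pub = none then s + v + 13 + B.init.length else s + v + 8
  | some (.trCell _ p) => if p = 0 then s + v + 12 + B.init.length else s + v + 7
  | some (.newInst _ _ _) => s + v + 11 + B.init.length
  | some (.newBinding _ _ _ _ _ _ rest) => s + v + 11 + rest.length
  | some (.newAB _ _ _ _) => s + v + 10
  | some (.casAB _ _ _ _ _) => s + v + 9
  | some (.freeze _ _ _ _ _) => v + 6 + (s - stepsTaken ρ)
  | some (.convert _ _ _ _) => 5 + (v - stepsTaken ρ)
  | some (.newB _ _ _) => 4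
  | some (.casB _ _ _) => 3
  | some (.noop _) => 3
  | some .stuck => 0

theorem weight_mono {φ φ' : Phase} (h : φ.Le φ') (s v : ℕ) (ρ : Role A B F C)
    (pt : Option (Point A B F C)) : weight s v φ' ρ pt ≤ weight s v φ ρ pt := by
  rcases pt with _ | pt
  · exact le_rfl
  · cases h with
    | refl => exact le_rfl
    | _ =>
      cases pt <;> simp only [weight, Phase.pub, Phase.cellB, le_refl] <;> split_ifs <;>
        simp_all <;> omega

theorem weight_le (s v : ℕ) (φ : Phase) (ρ : Role A B F C) (pt : Option (Point A B F C))
    (hrest : ∀ c p a i ℓ w rest, pt = some (.newBinding c p a i ℓ w rest) →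
      rest.length ≤ B.init.length) :
    weight s v φ ρ pt ≤ s + v + 13 + B.init.length := by
  rcases pt with _ | pt
  · exact le_rfl
  · cases pt <;> simp only [weight] <;> try split_ifs
    case newBinding => have := hrest _ _ _ _ _ _ _ rfl; omega
    all_goals omega

/-- What an operation of the thread `τ` that leads from the point `pt` to the point `pt'` achieves:
it is an operation of `A`, or one of `B`, or the weight of the thread decreases, provided that
`s` and `v` bound its current call of `freeze` or `convert`. -/
def Progress (G G' : Ghost A B F C) (τ : T) (pt pt' : Point A B F C) : Prop :=
  (A.Run 1 G.α G'.α ∧ ∀ s v, weight s v G'.φ (G'.s.role τ) (some pt') ≤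
      weight s v G.φ (G.s.role τ) (some pt)) ∨
  (B.Run 1 G.s.stateB G'.s.stateB ∧ G.s.converted ∧ A.Run 0 G.α G'.α ∧
    ∀ s v, weight s v G'.φ (G'.s.role τ) (some pt') ≤
      weight s v G.φ (G.s.role τ) (some pt)) ∨
  (A.Run 0 G.α G'.α ∧ ∀ s v, (∀ n k, G'.s.role τ = .freezing n k → n ≤ s) →
    (∀ n k, G'.s.role τ = .converting n k → n ≤ v) →
    weight s v G'.φ (G'.s.role τ) (some pt') < weight s v G.φ (G.s.role τ) (some pt))

/-- The residual program, if there is one. -/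
def residual : Cont A B F C → Option (Point A B F C)
  | .more k => some k
  | .done _ => none

open Classical in
/-- After an operation that leads the thread `τ` from `pt` to `x`, the invariant holds again and
there is progress. -/
def Preserved (G : Ghost A B F C) (P : T → Option (Point A B F C)) (τ : T) (pt : Point A B F C)
    (x : Cont A B F C) (μ' : Mem (Loc A B) (Val A B)) : Prop :=
  ∃ G', G.Ext τ G' ∧ Inv G' μ' (Function.update P τ (residual x)) ∧
    ∀ k, x = .more k → Progress G G' τ pt k

/-! ### Restoring the invariant of the memory -/

section Restore

variable {G G' : Ghost A B F C} {μ μ' : Mem (Loc A B) (Val A B)} {S : Set (Loc A B)}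
  {P : T → Option (Point A B F C)} {τ : T} {pt : Point A B F C} {x : Cont A B F C}

theorem MemInv.cell_unique (h : MemInv G μ) {p : ℕ} {st st' : HState A.L B.L}
    (h₁ : G.φ.Cell A B p st) (h₂ : G.φ.Cell A B p st') : st = st' := by
  have := (h.cell p st h₁).symm.trans (h.cell p st' h₂)
  simpa using this

/-- Any change of the memory outside of the root, the published cells and the address spaces that
are in use. -/
theorem MemInv.of_frame (h : MemInv G μ) (hf : Frame S μ μ') (hφ : G'.φ = G.φ)
    (hA : Sim HLoc.a HVal.a μ' G'.s.memA)
    (hB : ∀ q i, G.φ.pub = some (q, i) → Sim (HLoc.b i) HVal.b μ' G'.s.memB)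
    (hinst : ∀ i, HLoc.inst i ∈ S → μ'.heap.get (.inst i) ≠ none)
    (hroot : HLoc.root ∉ S) (hcell : ∀ p, HLoc.cell p ∈ S → μ.heap.get (.cell p) = none)
    (hb : ∀ i ℓ, HLoc.b i ℓ ∈ S → μ'.heap.get (.inst i) ≠ none) : MemInv G' μ' := by
  have hinst' : ∀ i, μ.heap.get (.inst i) ≠ none → μ'.heap.get (.inst i) ≠ none := by
    intro i hi
    by_cases hS : HLoc.inst i ∈ S
    · exact hinst i hS
    · rwa [(hf _ hS).1]
  refine ⟨hA, fun q i hq => ?_, ?_, ?_, fun p st hp => ?_, fun i hi ℓ => ?_⟩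
  · rw [hφ] at hq
    exact ⟨hB q i hq, hinst' i (h.simB q i hq).2⟩
  · rw [(hf _ hroot).1, hφ]; exact h.root
  · rw [(hf _ hroot).2]; exact h.root_not_frozen
  · rw [hφ] at hp
    have := h.cell p st hp
    rwa [(hf (.cell p) fun hS => by simp [hcell p hS] at this).1]
  · have hℓ : HLoc.b i ℓ ∉ S := fun hS => hb i ℓ hS hi
    have hi' : μ.heap.get (.inst i) = none := by
      by_contra hne
      exact hinst' i hne hi
    rw [(hf _ hℓ).1, (hf _ hℓ).2]
    exact h.fresh i hi' ℓ

theorem Private.of_frame {i : ℕ} {l : List (B.L × B.V)} (h : Private G μ i l)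
    (hf : Frame S μ μ') (hφ : ∀ q, G'.φ.pub ≠ some (q, i)) (hi : HLoc.inst i ∉ S)
    (hb : ∀ ℓ, HLoc.b i ℓ ∉ S) : Private G' μ' i l :=
  h.mono (by rw [(hf _ hi).1]; exact h.inst) hφ fun ℓ => hf _ (hb ℓ)

theorem Inv.private_of_owned (h : Inv G μ P) {i : ℕ} {τ : T} (hi : owned (P τ) = some i) :
    ∃ l, Private G μ i l :=
  (h.thread τ).owned_private hi

/-- Operations in a part `S` of the memory that contains no bound cell, no bound record, and
nothing that another thread is preparing for publication. -/
theorem Inv.preserved_of_frame (h : Inv G μ P) (hf : Frame S μ μ') (hG : G.Ext τ G')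
    (hφ : G'.φ = G.φ) (hv : G'.Valid) (hm : MemInv G' μ')
    (hcell : ∀ p, HLoc.cell p ∈ S → μ.heap.get (.cell p) = none)
    (hinst : ∀ i, HLoc.inst i ∈ S → μ.heap.get (.inst i) = none)
    (hb : ∀ i ℓ τ', τ' ≠ τ → owned (P τ') = some i → HLoc.b i ℓ ∉ S)
    (hx : ThreadInv G' μ' τ (residual x))
    (hown : ∀ i τ', owned (residual x) = some i → τ' ≠ τ → owned (P τ') ≠ some i)
    (hp : ∀ k, x = .more k → Progress G G' τ pt k) : Preserved G P τ pt x μ' := by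
  refine ⟨G', hG, h.update hG hv hm (fun q w hq => ?_) (fun τ' i l hτ hi hp => ?_) hx hown, hp⟩
  · rwa [(hf (.cell q) fun hS => by simp [hcell q hS] at hq).1]
  · exact hp.of_frame hf (fun q => hφ ▸ hp.not_pub q) (fun hS => hp.inst (hinst i hS))
      fun ℓ => hb i ℓ τ' hτ hi

theorem Inv.owned_of_eq (h : Inv G μ P) {i : ℕ} (hi : owned (P τ) = some i) :
    ∀ τ', τ' ≠ τ → owned (P τ') ≠ some i :=
  fun _ hτ h' => hτ (h.owned_ne _ _ _ h' hi)

/-- Operations that change nothing but the program point of the thread. -/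
theorem Inv.preserved_of_local (h : Inv G μ P) (hx : ThreadInv G μ τ (residual x))
    (hown : owned (residual x) = none)
    (hp : ∀ k, x = .more k → ∀ s v, (∀ n k, G.s.role τ = .freezing n k → n ≤ s) →
      (∀ n k, G.s.role τ = .converting n k → n ≤ v) →
      weight s v G.φ (G.s.role τ) (some k) < weight s v G.φ (G.s.role τ) (some pt)) :
    Preserved G P τ pt x μ :=
  h.preserved_of_frame (Frame.refl ∅ μ) (.refl G τ) rfl h.valid h.mem (by simp) (by simp)
    (by simp) hx (by simp [hown]) fun k hk => Or.inr (Or.inr ⟨.refl _, hp k hk⟩)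

theorem exec_read {ℓ : Loc A B} {k : Val A B → Cont A B F C} {w : Val A B}
    (h : Exec (read ℓ k) μ x μ') (hw : μ.heap.get ℓ = some w) (hd : w ≠ .dummy) :
    x = k w ∧ μ' = μ := by
  cases h with
  | casFrozen hv _ =>
    rw [hw] at hv
    cases hv
    exact ⟨rfl, rfl⟩
  | casFail hv _ _ =>
    rw [hw] at hv
    cases hv
    exact ⟨rfl, rfl⟩
  | casSuccess hv _ =>
    rw [hw] at hv
    cases hv
    exact absurd rfl hd

end Restore

/-! ### Steps of the accompanying transition -/

namespace Ghost.Valid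

variable {G : Ghost A B F C} {τ : T}

/-- A step of the transition that involves no method of `A`. -/
theorem transStep (hG : G.Valid) {s' : TransState A B F C}
    (hs : Relation.ReflTransGen TransState.Step G.s s') (hφ : G.φ.pub ≠ none)
    (hheap : s'.memA.heap = G.s.memA.heap) (hc : G.s.converted → s'.converted) :
    Ghost.Valid ⟨G.α, s', G.φ⟩ := by
  obtain ⟨σ, hσ, h0, hr⟩ := hG.occurs
  refine ⟨hG.isState, ⟨σ, hσ, h0, hr.trans hs⟩, ?_, fun h => ?_, fun q hq => hc (hG.converted q hq)⟩
  · dsimp only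
    rw [hG.memA, hheap]
  · dsimp only at h
    exact absurd (by rw [h]; rfl) hφ

theorem not_frozen_of_phaseA (hG : G.Valid) (hφ : G.φ = .A) : G.s.memA.frozen = ∅ := by
  have h := hG.start hφ
  have hm := hG.memA
  have : G.s.memA = G.α.mem := by rw [h]; rfl
  rw [this, hm]

/-- A thread that has not used `A` since the transition began calls a method of `A`. -/
theorem callA (hG : G.Valid) (m : M) (hρ : G.s.role τ = .pending) (hp : G.α.pool τ = none) :
    ∃ G', G.Ext τ G' ∧ G'.φ = G.φ ∧ G'.Valid ∧ G'.s.memA = G.s.memA ∧ G'.s.memB = G.s.memB ∧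
      G'.s.role τ = .runA (A.body m A.root) ∧ G'.α.pool τ = some (m, A.body m A.root) ∧
      A.Run 0 G.α G'.α := by
  classical
  obtain ⟨⟨mα, pα⟩, ⟨mA, mB, c, ρ⟩, φ⟩ := G
  obtain ⟨hst, ⟨σ, hσ, h0, hr⟩, hmem, hA, hc⟩ := hG
  dsimp only at *
  refine ⟨⟨⟨mα, Function.update pα τ (some (m, A.body m A.root))⟩,
    ⟨mA, mB, c, Function.update ρ τ (.runA (A.body m A.root))⟩, φ⟩,
    ⟨.refl _, id, fun τ' h => Function.update_of_ne h _ _, fun τ' h => Function.update_of_ne h _ _⟩,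
    rfl, ⟨?_, ⟨σ, hσ, h0, hr.tail ?_⟩, hmem, fun hφ => ?_, hc⟩, rfl, rfl, by simp, by simp,
    .call m hp ?_⟩
  · have := A.isState_step (fun _ => τ) ⟨⟨mα, pα⟩, 0, []⟩ _ hst (.call m hp)
    convert this
  · convert TransState.Step.callA m hρ
  · have := hA hφ
    simp only [TransState.start, TransState.mk.injEq] at this ⊢
    obtain ⟨h1, h2, h3, h4⟩ := this
    refine ⟨h1, h2, h3, ?_⟩
    funext τ'
    by_cases h : τ' = τ
    · subst h; simp [Role.ofA]
    · simp [Function.update_of_ne h, h4]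
  · convert Impl.Run.refl _

/-- An operation of a method of `A`, through freezable references.  The state `α` takes part,
unless there is an exception. -/
theorem opA (hAF : A.FreezeFree) (hG : G.Valid) {m : M} {k : A.K} {y : Option (Next A.K R)}
    {μ' : Mem A.L A.V} (hρ : G.s.role τ = .runA k) (hp : G.α.pool τ = some (m, k))
    (he : Exec (A.act k).freezable G.s.memA y μ') :
    ∃ G', G.Ext τ G' ∧ G'.φ = G.φ ∧ G'.Valid ∧ G'.s.memA = μ' ∧ G'.s.memB = G.s.memB ∧
      ((y = none ∧ G.φ.pub ≠ none ∧ G'.Idle τ ∧ A.Run 0 G.α G'.α) ∨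
        (∃ k', y = some (.more k') ∧ G'.s.role τ = .runA k' ∧ G'.α.pool τ = some (m, k') ∧
          A.Run 1 G.α G'.α) ∨
        (∃ r, y = some (.done r) ∧ G'.Idle τ)) := by
  classical
  obtain ⟨hfr, ⟨rfl, rfl, hne⟩ | ⟨x, rfl, hx⟩⟩ := he.of_freezable (hAF k)
  · have hφ : G.φ.pub ≠ none := by
      intro h
      refine hne (hG.not_frozen_of_phaseA ?_)
      cases hφ : G.φ <;> simp_all [Phase.pub]
    refine ⟨⟨G.α, ⟨G.s.memA, G.s.memB, G.s.converted, Function.update G.s.role τ .free⟩, G.φ⟩,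
      ⟨.refl _, id, fun τ' h => Function.update_of_ne h _ _, fun _ _ => rfl⟩, rfl,
      hG.transStep (.single ?_) hφ rfl id, rfl, rfl,
      Or.inl ⟨rfl, hφ, Or.inl (by simp), .refl _⟩⟩
    have := TransState.Step.opA (ν := G.s.memB) (c := G.s.converted) hρ he
    convert this
    rfl
  · obtain ⟨⟨mα, pα⟩, ⟨mA, mB, c, ρ⟩, φ⟩ := G
    obtain ⟨hst, ⟨σ, hσ, h0, hr⟩, hmem, hA, hc⟩ := hG
    dsimp only at *
    subst hmem
    cases x with
    | more k' =>
      refine ⟨⟨⟨⟨μ'.heap, ∅⟩, Function.update pα τ (some (m, k'))⟩,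
        ⟨μ', mB, c, Function.update ρ τ (.runA k')⟩, φ⟩,
        ⟨.refl _, id, fun τ' h => Function.update_of_ne h _ _,
          fun τ' h => Function.update_of_ne h _ _⟩,
        rfl, ⟨?_, ⟨σ, hσ, h0, hr.tail ?_⟩, rfl, fun hφ => ?_, hc⟩, rfl, rfl,
        Or.inr (Or.inl ⟨k', rfl, by simp, by simp, .op hp hx ?_⟩)⟩
      · have := A.isState_step (fun _ => τ) ⟨⟨⟨mA.heap, ∅⟩, pα⟩, 0, []⟩ _ hst (.op hp hx)
        convert this
      · have := TransState.Step.opA (ν := mB) (c := c) hρ he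
        convert this
        rfl
      · have := hA hφ
        simp only [TransState.start, TransState.mk.injEq] at this ⊢
        obtain ⟨h1, h2, h3, h4⟩ := this
        refine ⟨?_, h2, h3, ?_⟩
        · rw [h1] at hfr
          cases μ'
          simp only [Mem.mk.injEq, true_and]
          exact hfr
        · funext τ'
          by_cases h : τ' = τ
          · subst h; simp [Role.ofA]
          · simp [Function.update_of_ne h, h4]
      · convert Impl.Run.refl _
    | done r =>
      have hst' : A.IsState ⟨⟨μ'.heap, ∅⟩, Function.update pα τ none⟩ := by
        have := A.isState_step (fun _ => τ) ⟨⟨⟨mA.heap, ∅⟩, pα⟩, 0, []⟩ _ hst (.finish hp hx)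
        convert this
      by_cases hφ : φ = .A
      · have := hA hφ
        simp only [TransState.start, TransState.mk.injEq] at this
        obtain ⟨h1, h2, h3, h4⟩ := this
        subst hφ h2 h3 h4
        refine ⟨⟨⟨⟨μ'.heap, ∅⟩, Function.update pα τ none⟩,
          TransState.start B F C ⟨⟨μ'.heap, ∅⟩, Function.update pα τ none⟩, .A⟩,
          ⟨.refl _, id, fun τ' h => ?_, fun τ' h => Function.update_of_ne h _ _⟩,
          rfl, ⟨hst', ⟨_, hst', rfl, .refl⟩, rfl, fun _ => rfl, hc⟩, ?_, rfl,
          Or.inr (Or.inr ⟨r, rfl, Or.inr ⟨?_, ?_⟩⟩)⟩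
        · simp [TransState.start, Function.update_of_ne h]
        · rw [h1] at hfr
          cases μ'
          simp only [TransState.start, Mem.mk.injEq, true_and]
          exact hfr.symm
        · simp [TransState.start, Role.ofA]
        · simp
      · refine ⟨⟨⟨⟨μ'.heap, ∅⟩, Function.update pα τ none⟩,
          ⟨μ', mB, c, Function.update ρ τ .free⟩, φ⟩,
          ⟨.refl _, id, fun τ' h => Function.update_of_ne h _ _,
            fun τ' h => Function.update_of_ne h _ _⟩,
          rfl, ⟨hst', ⟨σ, hσ, h0, hr.tail ?_⟩, rfl, fun h => absurd h hφ, hc⟩, rfl, rfl,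
          Or.inr (Or.inr ⟨r, rfl, Or.inl (by simp)⟩)⟩
        have := TransState.Step.opA (ν := mB) (c := c) hρ he
        convert this
        rfl

end Ghost.Valid

/-! ### Every operation preserves the invariant -/

section Ops

variable {G : Ghost A B F C} {μ μ' : Mem (Loc A B) (Val A B)}
  {P : T → Option (Point A B F C)} {τ : T} {x : Cont A B F C}

theorem MemInv.phase_eq_A (h : MemInv G μ) (h0 : G.φ.rootCell = 0) : G.φ = .A := by
  cases hφ : G.φ with
  | A => rfl
  | AB q i =>
    rw [hφ] at h0
    have := h.cell_unique .a (.ab (q := 0) (i := i) (by rw [hφ, ← h0]; rfl))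
    simp at this
  | B q i q' =>
    rw [hφ] at h0
    have := h.cell_unique .a (.b (q := q) (i := i) (by rw [hφ]; rfl) (by rw [hφ, ← h0]; rfl))
    simp at this

theorem Inv.rwRoot (h : Inv G μ P) {m : M} (hP : P τ = some (.rwRoot m))
    (he : Exec (act (.rwRoot m)) μ x μ') : Preserved G P τ (.rwRoot m) x μ' := by
  have ht : G.Idle τ := by simpa [hP, ThreadInv] using h.thread τ
  obtain ⟨rfl, rfl⟩ := exec_read he h.mem.root (by simp)
  refine h.preserved_of_local ⟨ht, Phase.cell_rootCell A B G.φ,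
    fun h0 => (h.valid.pending_of_phaseA (h.mem.phase_eq_A h0) ht).1⟩ rfl ?_
  rintro k hk s v - -
  cases hk
  cases hφ : G.φ <;> simp [weight, Phase.cellB, Phase.rootCell]

theorem Inv.trRoot (h : Inv G μ P) {c : Option M} (hP : P τ = some (.trRoot c))
    (he : Exec (act (.trRoot c)) μ x μ') : Preserved G P τ (.trRoot c) x μ' := by
  have ht : G.Idle τ := by simpa [hP, ThreadInv] using h.thread τ
  obtain ⟨rfl, rfl⟩ := exec_read he h.mem.root (by simp)
  refine h.preserved_of_local ⟨ht, Phase.cell_rootCell A B G.φ⟩ rfl ?_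
  rintro k hk s v - -
  cases hk
  by_cases h0 : G.φ.rootCell = 0
  · simp [weight, h.mem.phase_eq_A h0, Phase.pub, Phase.rootCell]
  · simp only [weight, h0, if_false]
    split_ifs <;> omega

theorem Inv.noop (h : Inv G μ P) {c : Option M} (hP : P τ = some (.noop c))
    (he : Exec (act (.noop c)) μ x μ') : Preserved G P τ (.noop c) x μ' := by
  have ht : G.Idle τ ∧ G.φ.cellB ≠ none := by simpa [hP, ThreadInv] using h.thread τ
  obtain ⟨rfl, rfl⟩ := exec_read he h.mem.root (by simp)
  cases c with
  | none => exact h.preserved_of_local ht.1 rfl (by rintro k ⟨⟩)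
  | some m =>
    refine h.preserved_of_local ht.1 rfl ?_
    rintro k hk s v - -
    cases hk
    simp [weight, ht.2]

theorem Inv.trCell (h : Inv G μ P) {c : Option M} {p : ℕ} (hP : P τ = some (.trCell c p))
    (he : Exec (act (.trCell c p)) μ x μ') : Preserved G P τ (.trCell c p) x μ' := by
  classical
  have ht := h.thread τ
  rw [hP] at ht
  obtain ⟨hi, st, hst⟩ := ht
  obtain ⟨rfl, rfl⟩ := exec_read he (h.mem.cell p st hst) (by simp)
  cases hst with
  | a =>
    refine h.preserved_of_local ⟨hi, rfl, rfl⟩ rfl ?_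
    rintro k hk s v - -
    cases hk
    simp [weight]
  | @ab _ i hq =>
    have h0 : p ≠ 0 := by
      rintro rfl
      have := h.mem.cell_unique (.ab hq) .a
      simp at this
    refine h.preserved_of_frame (G' := ⟨G.α, ⟨G.s.memA, G.s.memB, G.s.converted,
      Function.update G.s.role τ (.freezing 0 (F.start A.root))⟩, G.φ⟩) (Frame.refl ∅ _)
      ⟨.refl _, id, fun τ' h => Function.update_of_ne h _ _, fun _ _ => rfl⟩ rfl
      (h.valid.transStep (.single ?_) (by simp [hq]) rfl id)
      ⟨h.mem.simA, h.mem.simB, h.mem.root, h.mem.root_not_frozen, h.mem.cell, h.mem.fresh⟩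
      (by simp) (by simp) (by simp) ⟨rfl, rfl, hq, 0, by simp⟩ (by simp [residual, owned]) ?_
    · have := TransState.Step.callFreeze (μ := G.s.memA) (ν := G.s.memB) (c := G.s.converted)
        (ρ := G.s.role) hi.available
      convert this
    · rintro k hk
      cases hk
      refine Or.inr (Or.inr ⟨.refl _, fun s v _ _ => ?_⟩)
      simp [weight, stepsTaken, h0]
      omega
  | @b q _ _ hq hb =>
    have h0 : p ≠ 0 := by
      rintro rfl
      have := h.mem.cell_unique (.b hq hb) .a
      simp at this
    refine h.preserved_of_local ⟨hi, by simp [hb]⟩ rfl ?_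
    rintro k hk s v - -
    cases hk
    simp only [weight, h0, if_false]
    omega

theorem Inv.rwCell (h : Inv G μ P) {m : M} {p : ℕ} (hP : P τ = some (.rwCell m p))
    (he : Exec (act (.rwCell m p)) μ x μ') : Preserved G P τ (.rwCell m p) x μ' := by
  classical
  have ht := h.thread τ
  rw [hP] at ht
  obtain ⟨hi, ⟨st, hst⟩, hpend⟩ := ht
  obtain ⟨rfl, rfl⟩ := exec_read he (h.mem.cell p st hst) (by simp)
  have hnb : (∀ b, st ≠ .B b) → G.φ.cellB ≠ some p := by
    intro hne hb
    obtain ⟨q, i, q', hφ⟩ : ∃ q i q', G.φ = .B q i q' := by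
      cases hφ : G.φ <;> simp_all [Phase.cellB]
    exact hne _ (h.mem.cell_unique hst (.b (by rw [hφ]; rfl) hb))
  cases hst with
  | a =>
    have hρ := hpend rfl
    have hp : G.α.pool τ = none := (hi.resolve_left (by simp [hρ])).2
    obtain ⟨G', hE, hφ, hv, hA, hB, hρ', hp', hr⟩ := h.valid.callA m hρ hp
    refine h.preserved_of_frame (Frame.refl ∅ _) hE hφ hv
      (h.mem.of_frame (Frame.refl ∅ _) hφ (hA ▸ h.mem.simA)
        (fun q i hq => hB ▸ (h.mem.simB q i hq).1) (by simp) (by simp) (by simp) (by simp))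
      (by simp) (by simp) (by simp) ⟨hρ', hp'⟩ (by simp [residual, owned]) ?_
    rintro k hk
    cases hk
    refine Or.inr (Or.inr ⟨hr, fun s v _ _ => ?_⟩)
    have := hnb (by simp)
    simp [weight, this]
  | ab hq =>
    refine h.preserved_of_local hi rfl ?_
    rintro k hk s v - -
    cases hk
    have := hnb (by simp)
    simp [weight, this, hq]
  | @b q i _ hq hb =>
    refine h.preserved_of_frame (G' := ⟨G.α, ⟨G.s.memA, G.s.memB, G.s.converted,
      Function.update G.s.role τ (.runB m (B.body m B.root))⟩, G.φ⟩) (Frame.refl ∅ _)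
      ⟨.refl _, id, fun τ' h => Function.update_of_ne h _ _, fun _ _ => rfl⟩ rfl
      (h.valid.transStep (.single ?_) (by simp [hq]) rfl id)
      ⟨h.mem.simA, h.mem.simB, h.mem.root, h.mem.root_not_frozen, h.mem.cell, h.mem.fresh⟩
      (by simp) (by simp) (by simp) ⟨h.valid.converted _ hb, ⟨q, hq⟩, by simp⟩
      (by simp [residual, owned]) ?_
    · have := TransState.Step.callB (μ := G.s.memA) (ν := G.s.memB) (c := G.s.converted)
        (ρ := G.s.role) m (h.valid.converted _ hb) hi.available
      convert this
    · rintro k hk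
      cases hk
      refine Or.inr (Or.inr ⟨.refl _, fun s v _ _ => ?_⟩)
      simp [weight, hb]
/-- Allocations outside of the address space of `A` and of the published instance of `B`. -/
theorem MemInv.set_new {H : Heap (Loc A B) (Val A B)} {K : Set (Loc A B)}
    (h : MemInv G ⟨H, K⟩) {ℓ : Loc A B} {w : Val A B} (hn : H.get ℓ = none)
    (hA : ∀ a, ℓ ≠ .a a) (hB : ∀ q i b, G.φ.pub = some (q, i) → ℓ ≠ .b i b)
    (hb : ∀ i b, ℓ = .b i b → H.get (.inst i) ≠ none) : MemInv G ⟨H.set ℓ w, K⟩ := by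
  have hf := Frame.set H K ℓ w
  refine h.of_frame hf rfl (h.simA.of_frame hf fun a h => hA a (by simpa using h.symm))
    (fun q i hq => (h.simB q i hq).1.of_frame hf fun b h => hB q i b hq (by simpa using h.symm))
    (fun i hi => ?_) (fun hr => ?_) (fun p hp => ?_) fun i b hi => ?_
  · obtain rfl : .inst i = ℓ := by simpa using hi
    simp [Heap.set_get_self]
  · obtain rfl : .root = ℓ := by simpa using hr
    have := h.root
    simp only at this
    simp [hn] at this
  · obtain rfl : .cell p = ℓ := by simpa using hp
    exact hn
  · obtain rfl : .b i b = ℓ := by simpa using hi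
    simpa [Heap.set_get_of_ne] using hb i b rfl

theorem Inv.newInst (h : Inv G μ P) {c : Option M} {p : ℕ} {a : A.L}
    (hP : P τ = some (.newInst c p a)) (he : Exec (act (.newInst c p a)) μ x μ') :
    Preserved G P τ (.newInst c p a) x μ' := by
  have ht := h.thread τ
  rw [hP] at ht
  obtain ⟨hi, rfl, rfl⟩ := ht
  cases he with
  | @new _ _ _ H K ℓ hs hn =>
    obtain ⟨i, rfl⟩ := hs
    have hf := Frame.set H K (HLoc.inst i) (HVal.dummy : Val A B)
    have hm : MemInv G ⟨H.set (.inst i) .dummy, K⟩ := h.mem.set_new hn (by simp) (by simp) (by simp)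
    have hpriv : Private G ⟨H.set (.inst i) .dummy, K⟩ i [] :=
      ⟨by simp [Heap.set_get_self], fun q hq => (h.mem.simB q i hq).2 hn,
        fun ℓ x => by
          have := (h.mem.fresh i hn ℓ).1
          dsimp only at this
          simp [Heap.set_get_of_ne, this],
        fun ℓ => (h.mem.fresh i hn ℓ).2⟩
    refine h.preserved_of_frame hf (.refl G τ) rfl h.valid hm
      (by simp) (by simpa using hn) (by simp) ?_ (fun j τ' hj hτ hj' => ?_) ?_
    · cases hB : B.init with
      | nil => exact ⟨hi, rfl, rfl, rfl, by rwa [hB]⟩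
      | cons b rest => exact ⟨hi, rfl, rfl, [], by simpa using hB, hpriv⟩
    · obtain ⟨l, hl⟩ := h.private_of_owned hj'
      refine hl.inst ?_
      obtain rfl : i = j := by cases hB : B.init <;> simpa [hB, residual, copyB, owned] using hj
      exact hn
    · rintro k hk
      refine Or.inr (Or.inr ⟨.refl _, fun s v _ _ => ?_⟩)
      cases hk
      cases hB : B.init <;> simp [copyB, weight, hB]

theorem Inv.newBinding (h : Inv G μ P) {c : Option M} {p : ℕ} {a : A.L} {i : ℕ} {ℓ : B.L}
    {w : B.V} {rest : List (B.L × B.V)} (hP : P τ = some (.newBinding c p a i ℓ w rest))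
    (he : Exec (act (.newBinding c p a i ℓ w rest)) μ x μ') :
    Preserved G P τ (.newBinding c p a i ℓ w rest) x μ' := by
  have ht := h.thread τ
  rw [hP] at ht
  obtain ⟨hi, rfl, rfl, dn, hdn, hp⟩ := ht
  cases he with
  | @new _ _ _ H K ℓ' hs hn =>
    obtain rfl : ℓ' = .b i ℓ := by simpa using hs
    have hf := Frame.set H K (HLoc.b i ℓ) (HVal.b w : Val A B)
    have hm : MemInv G ⟨H.set (.b i ℓ) (.b w), K⟩ := by
      refine h.mem.set_new hn (by simp) (fun q j b hq hb => ?_) (fun j b hb => ?_)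
      · simp only [HLoc.b.injEq] at hb
        exact hp.not_pub q (hb.1 ▸ hq)
      · simp only [HLoc.b.injEq] at hb
        exact hb.1 ▸ hp.inst
    have hpriv : Private G ⟨H.set (.b i ℓ) (.b w), K⟩ i (dn ++ [(ℓ, w)]) := by
      refine ⟨by simpa [Heap.set_get_of_ne] using hp.inst, hp.not_pub, fun ℓ' x => ?_,
        hp.not_frozen⟩
      have hget := hp.get ℓ' x
      dsimp only at hget ⊢
      by_cases hℓ : ℓ' = ℓ
      · subst hℓ
        rw [Heap.set_get_self]
        have hnot : ∀ v, (ℓ', v) ∉ dn := fun v hv => by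
          have := (hp.get ℓ' (.b v)).2 ⟨v, hv, rfl⟩
          dsimp only at this
          rw [hn] at this
          cases this
        simp [hnot, eq_comm]
      · rw [Heap.set_get_of_ne _ _ (by simpa using hℓ), hget]
        simp [hℓ]
    have hdn' : B.init = (dn ++ [(ℓ, w)]) ++ rest := by simpa using hdn
    refine h.preserved_of_frame hf (.refl G τ) rfl h.valid hm
      (by simp) (by simp) (fun j ℓ' τ' hτ hj hℓ => ?_) ?_ (fun j τ' hj hτ => ?_) ?_
    · simp only [Set.mem_singleton_iff, HLoc.b.injEq] at hℓ
      exact h.owned_of_eq (τ := τ) (by rw [hP]; rfl) τ' hτ (hℓ.1 ▸ hj)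
    · cases rest with
      | nil => exact ⟨hi, rfl, rfl, rfl, by simpa [hdn'] using hpriv⟩
      | cons b rest => exact ⟨hi, rfl, rfl, _, hdn', hpriv⟩
    · refine h.owned_of_eq (τ := τ) ?_ τ' hτ
      rw [hP]
      cases rest <;> simpa [residual, copyB, owned] using hj
    · rintro k hk
      refine Or.inr (Or.inr ⟨.refl _, fun s v _ _ => ?_⟩)
      cases hk
      cases rest <;> simp [copyB, weight]

theorem Inv.newAB (h : Inv G μ P) {c : Option M} {p : ℕ} {a : A.L} {b : ℕ × B.L}
    (hP : P τ = some (.newAB c p a b)) (he : Exec (act (.newAB c p a b)) μ x μ') :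
    Preserved G P τ (.newAB c p a b) x μ' := by
  have ht := h.thread τ
  rw [hP] at ht
  obtain ⟨hi, rfl, rfl, hb, hp⟩ := ht
  cases he with
  | @new _ _ _ H K ℓ hs hn =>
    obtain ⟨q, rfl⟩ := hs
    have hf := Frame.set H K (HLoc.cell q) (HVal.state (.AB A.root b) : Val A B)
    refine h.preserved_of_frame hf (.refl G τ) rfl h.valid
      (h.mem.set_new hn (by simp) (by simp) (by simp))
      (by simpa using hn) (by simp) (by simp)
      ⟨hi, rfl, rfl, hb, hp.of_frame hf hp.not_pub (by simp) (by simp), Heap.set_get_self _ _ _⟩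
      (fun j τ' hj hτ => h.owned_of_eq (τ := τ) (by rw [hP]; exact hj) τ' hτ) ?_
    rintro k hk
    cases hk
    refine Or.inr (Or.inr ⟨.refl _, fun s v _ _ => ?_⟩)
    simp [weight]

theorem Inv.newB (h : Inv G μ P) {c : Option M} {p : ℕ} {b : ℕ × B.L}
    (hP : P τ = some (.newB c p b)) (he : Exec (act (.newB c p b)) μ x μ') :
    Preserved G P τ (.newB c p b) x μ' := by
  have ht := h.thread τ
  rw [hP] at ht
  obtain ⟨i, b⟩ := b
  obtain ⟨hi, hc, rfl, hpub⟩ := ht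
  cases he with
  | @new _ _ _ H K ℓ hs hn =>
    obtain ⟨q, rfl⟩ := hs
    have hf := Frame.set H K (HLoc.cell q) (HVal.state (.B (i, B.root)) : Val A B)
    refine h.preserved_of_frame hf (.refl G τ) rfl h.valid
      (h.mem.set_new hn (by simp) (by simp) (by simp))
      (by simpa using hn) (by simp) (by simp)
      ⟨hi, hc, i, hpub, Heap.set_get_self _ _ _⟩ (by simp [residual, owned]) ?_
    rintro k hk
    cases hk
    refine Or.inr (Or.inr ⟨.refl _, fun s v _ _ => ?_⟩)
    simp [weight]

theorem Private.sim {i : ℕ} (h : Private G μ i B.init) :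
    Sim (HLoc.b i) HVal.b μ B.initMem := by
  refine ⟨fun ℓ => Option.ext fun x => ?_, fun ℓ => by simpa [Impl.initMem] using h.not_frozen ℓ⟩
  rw [h.get ℓ x, Option.map_eq_some_iff]
  simp only [Impl.initMem, Heap.ofList_get_eq_some B.init_nodup, eq_comm]

/-- Changing the root. -/
theorem MemInv.set_root {H : Heap (Loc A B) (Val A B)} {K : Set (Loc A B)}
    (h : MemInv G ⟨H, K⟩) {G' : Ghost A B F C} {q : ℕ} (hA : G'.s.memA = G.s.memA)
    (hB : ∀ q i, G'.φ.pub = some (q, i) →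
      Sim (HLoc.b i) HVal.b ⟨H, K⟩ G'.s.memB ∧ H.get (.inst i) ≠ none)
    (hq : q = G'.φ.rootCell)
    (hcell : ∀ p st, G'.φ.Cell A B p st → H.get (.cell p) = some (.state st)) :
    MemInv G' ⟨H.set .root (.ptr q), K⟩ := by
  have hf := Frame.set H K HLoc.root (HVal.ptr q : Val A B)
  subst hq
  refine ⟨hA ▸ h.simA.of_frame hf (by simp),
    fun q i hq => ⟨(hB q i hq).1.of_frame hf (by simp), ?_⟩, Heap.set_get_self _ _ _,
    h.root_not_frozen, fun p st hp => ?_, fun i hi ℓ => ?_⟩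
  · simpa [Heap.set_get_of_ne] using (hB q i hq).2
  · simpa [Heap.set_get_of_ne] using hcell p st hp
  · simp only [Heap.set_get_of_ne _ _ (show HLoc.inst i ≠ HLoc.root by simp)] at hi
    simpa [Heap.set_get_of_ne] using h.fresh i hi ℓ

/-- If the root still points to the state `A a`, the prepared instance of `B` is published, and the
transition begins in the current state of `A`. -/
theorem Inv.casAB (h : Inv G μ P) {c : Option M} {p : ℕ} {a : A.L} {b : ℕ × B.L} {q : ℕ}
    (hP : P τ = some (.casAB c p a b q)) (he : Exec (act (.casAB c p a b q)) μ x μ') :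
    Preserved G P τ (.casAB c p a b q) x μ' := by
  classical
  have ht := h.thread τ
  rw [hP] at ht
  obtain ⟨i, b⟩ := b
  obtain ⟨hi, rfl, rfl, rfl, hp, hq⟩ := ht
  have hroot := h.mem.root
  cases he with
  | casFrozen hv hℓ => exact absurd hℓ h.mem.root_not_frozen
  | @casFail _ _ _ _ H K v hv hℓ hne =>
    obtain rfl : v = .ptr G.φ.rootCell := Option.some.inj (hv.symm.trans hroot)
    obtain ⟨st, hst⟩ := Phase.cell_rootCell A B G.φ
    -- A failed CAS returns the value of the root, which would look like success if it were `ptr q`;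
    -- but the cell `q` holds an unpublished instance.
    have hqr : G.φ.rootCell ≠ q := by
      rintro rfl
      obtain rfl : st = .AB A.root (i, B.root) := by
        have := (h.mem.cell _ _ hst).symm.trans hq
        simpa using this
      generalize G.φ.rootCell = r at hst
      cases hst with
      | ab hpub => exact hp.not_pub _ hpub
    beta_reduce
    rw [if_neg (by simpa using hqr)]
    refine h.preserved_of_local hi rfl ?_
    rintro k hk s v - -
    cases hk
    have hpub : G.φ.pub ≠ none := by
      cases hφ : G.φ with
      | A => simp [hφ, Phase.rootCell] at hne
      | _ => simp [Phase.pub]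
    simp [weight, hpub]
  | @casSuccess _ _ _ _ H K hv hℓ =>
    have h0 : G.φ.rootCell = 0 := by
      have := hroot.symm.trans hv
      simpa using this
    have hφ := h.mem.phase_eq_A h0
    have hs := h.valid.start hφ
    beta_reduce
    rw [if_pos rfl]
    have hle : G.φ.Le (.AB q i) := hφ ▸ .publish q i
    have hf := Frame.set H K HLoc.root (HVal.ptr q : Val A B)
    refine ⟨⟨G.α, ⟨G.s.memA, G.s.memB, G.s.converted,
      Function.update G.s.role τ (.freezing 0 (F.start A.root))⟩, .AB q i⟩,
      ⟨hle, id, fun τ' h => Function.update_of_ne h _ _, fun _ _ => rfl⟩, ?_, ?_⟩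
    · have hm : MemInv (⟨G.α, ⟨G.s.memA, G.s.memB, G.s.converted,
          Function.update G.s.role τ (.freezing 0 (F.start A.root))⟩, .AB q i⟩ : Ghost A B F C)
          ⟨H.set .root (.ptr q), K⟩ := by
        refine h.mem.set_root rfl (fun q' i' hq' => ?_) rfl (fun p st hc => ?_)
        · obtain ⟨rfl, rfl⟩ : q = q' ∧ i = i' := by simpa [Phase.pub] using hq'
          refine ⟨?_, hp.inst⟩
          dsimp only
          rw [hs]
          exact hp.sim
        · cases hc with
          | a => exact h.mem.cell _ _ .a
          | ab hpub =>
            obtain ⟨rfl, rfl⟩ : q = p ∧ i = _ := by simpa [Phase.pub] using hpub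
            exact hq
          | b _ hb => simp [Phase.cellB] at hb
      refine h.update ⟨hle, id, fun τ' h => Function.update_of_ne h _ _, fun _ _ => rfl⟩ ?_ hm
        (fun q x hq => by simpa [Heap.set_get_of_ne] using hq) (fun τ' i' l hτ ho hl => ?_)
        ⟨rfl, rfl, rfl, 0, by simp⟩ (by simp [residual, owned])
      · obtain ⟨σ, hσ, hσ0, hr⟩ := h.valid.occurs
        refine ⟨h.valid.isState, ⟨σ, hσ, hσ0, hr.tail ?_⟩, h.valid.memA, by simp,
          by simp [Phase.cellB]⟩
        have := TransState.Step.callFreeze (μ := G.s.memA) (ν := G.s.memB) (c := G.s.converted)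
          (ρ := G.s.role) hi.available
        convert this
      · refine hl.of_frame hf (fun q' hq' => ?_) (by simp) (by simp)
        obtain ⟨rfl, rfl⟩ : q = q' ∧ i = i' := by simpa [Phase.pub] using hq'
        exact h.owned_of_eq (τ := τ) (by rw [hP]; rfl) τ' hτ ho
    · rintro k hk
      cases hk
      refine Or.inr (Or.inr ⟨.refl _, fun s v _ _ => ?_⟩)
      simp [weight, stepsTaken]
      omega

/-- After the operation `casB` the root points to the state `B b`, whichever thread has put it
there. -/
theorem Inv.casB (h : Inv G μ P) {c : Option M} {p q : ℕ}
    (hP : P τ = some (.casB c p q)) (he : Exec (act (.casB c p q)) μ x μ') :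
    Preserved G P τ (.casB c p q) x μ' := by
  classical
  have ht := h.thread τ
  rw [hP] at ht
  obtain ⟨hi, hc, i, hpub, hq⟩ := ht
  have hroot := h.mem.root
  have hend : residual (endTransition c : Cont A B F C) = none ∨
      ∃ m, residual (endTransition c : Cont A B F C) = some (.rwRoot m) := by
    cases c with
    | none => exact Or.inl rfl
    | some m => exact Or.inr ⟨m, rfl⟩
  have hown : owned (residual (endTransition c : Cont A B F C)) = none := by
    rcases hend with h | ⟨m, h⟩ <;> rw [h] <;> rfl
  have hw : ∀ (φ : Phase) (ρ : Role A B F C), φ.cellB ≠ none → ∀ k,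
      (endTransition c : Cont A B F C) = .more k → ∀ s v,
        weight s v φ ρ (some k) < weight s v G.φ (G.s.role τ) (some (.casB c p q)) := by
    intro φ ρ hφ k hk s v
    cases c with
    | none => cases hk
    | some m =>
      cases hk
      simp [weight, hφ]
  cases he with
  | casFrozen hv hℓ => exact absurd hℓ h.mem.root_not_frozen
  | @casFail _ _ _ _ H K v hv hℓ hne =>
    obtain rfl : v = .ptr G.φ.rootCell := Option.some.inj (hv.symm.trans hroot)
    -- As long as the root points to the published `AB a b`, the CAS cannot fail.
    have hφ : G.φ.cellB ≠ none := by
      cases hφ : G.φ with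
      | A => simp [hφ, Phase.pub] at hpub
      | AB q' i' =>
        obtain ⟨rfl, rfl⟩ : q' = p ∧ i' = i := by simpa [hφ, Phase.pub] using hpub
        simp [hφ, Phase.rootCell] at hne
      | B => simp [Phase.cellB]
    refine h.preserved_of_local ?_ hown fun k hk s v _ _ => hw _ _ hφ k hk s v
    rcases hend with h | ⟨m, h⟩ <;> rw [h] <;> exact hi
  | @casSuccess _ _ _ _ H K hv hℓ =>
    have h0 : G.φ.rootCell = p := by
      have := hroot.symm.trans hv
      simpa using this
    have hφ : G.φ = .AB p i := by
      cases hφ : G.φ with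
      | A => simp [hφ, Phase.pub] at hpub
      | AB q' i' =>
        obtain ⟨rfl, rfl⟩ : q' = p ∧ i' = i := by simpa [hφ, Phase.pub] using hpub
        rfl
      | B q' i' q'' =>
        obtain rfl : q'' = p := by simpa [hφ, Phase.rootCell] using h0
        have := h.mem.cell_unique (.ab hpub) (.b hpub (by rw [hφ]; rfl))
        simp at this
    have hle : G.φ.Le (.B p i q) := hφ ▸ .close p i q
    have hE : G.Ext τ ⟨G.α, G.s, .B p i q⟩ := ⟨hle, id, fun _ _ => rfl, fun _ _ => rfl⟩
    have hf := Frame.set H K HLoc.root (HVal.ptr q : Val A B)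
    refine ⟨⟨G.α, G.s, .B p i q⟩, hE, h.update hE ?_ (h.mem.set_root rfl (fun q' i' hq' => ?_) rfl
        (fun p' st hc => ?_))
        (fun q x hq => by simpa [Heap.set_get_of_ne] using hq) (fun τ' i' l hτ ho hl => ?_)
        ?_ (by simp [hown]), fun k hk => ?_⟩
    · exact ⟨h.valid.isState, h.valid.occurs, h.valid.memA, by simp, fun _ _ => hc⟩
    · exact h.mem.simB q' i' (by rw [hφ]; exact hq')
    · cases hc with
      | a => exact h.mem.cell _ _ .a
      | ab hpub' => exact h.mem.cell _ _ (.ab (by rw [hφ]; exact hpub'))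
      | b hpub' hb =>
        simp only [Phase.pub, Phase.cellB, Option.some.injEq, Prod.mk.injEq] at hpub' hb
        obtain ⟨⟨rfl, rfl⟩, rfl⟩ := And.intro hpub' hb
        exact hq
    · exact hl.of_frame hf (fun q' hq' => hl.not_pub q' (by rw [hφ]; exact hq')) (by simp) (by simp)
    · rcases hend with h | ⟨m, h⟩ <;> rw [h] <;> exact hi
    · exact Or.inr (Or.inr ⟨.refl _, fun s v _ _ => hw _ _ (by simp [Phase.cellB]) k hk s v⟩)

end Ops

section Ops

variable {G G' : Ghost A B F C} {μ μ' : Mem (Loc A B) (Val A B)}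
  {P : T → Option (Point A B F C)} {τ : T} {x : Cont A B F C}

open Classical in
theorem Ghost.Ext.setRole {mA : Mem A.L A.V} {mB : Mem B.L B.V} {c : Prop} {ρ : Role A B F C}
    (hc : G.s.converted → c) :
    G.Ext τ ⟨G.α, ⟨mA, mB, c, Function.update G.s.role τ ρ⟩, G.φ⟩ :=
  ⟨.refl _, hc, fun _ h => Function.update_of_ne h _ _, fun _ _ => rfl⟩

theorem exec_onA {X : Type} {f : X → Cont A B F C} {a : Act A.L A.V X}
    (h : MemInv G μ) (he : Exec (onA f a) μ x μ') :
    ∃ y ν, Exec a G.s.memA y ν ∧ x = f y ∧ Sim HLoc.a HVal.a μ' ν ∧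
      Frame (Set.range HLoc.a) μ μ' :=
  he.of_embed (fun _ => rfl) (fun _ => rfl) h.simA

theorem exec_onB {X : Type} {q i : ℕ} {f : X → Cont A B F C} {a : Act B.L B.V X}
    (h : MemInv G μ) (hq : G.φ.pub = some (q, i)) (he : Exec (onB i f a) μ x μ') :
    ∃ y ν, Exec a G.s.memB y ν ∧ x = f y ∧ Sim (HLoc.b i) HVal.b μ' ν ∧
      Frame (Set.range (HLoc.b i)) μ μ' :=
  he.of_embed (fun _ => rfl) (fun _ => rfl) (h.simB q i hq).1

theorem MemInv.of_frameA (h : MemInv G μ) (hf : Frame (Set.range HLoc.a) μ μ')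
    (hφ : G'.φ = G.φ) (hA : Sim HLoc.a HVal.a μ' G'.s.memA) (hB : G'.s.memB = G.s.memB) :
    MemInv G' μ' :=
  h.of_frame hf hφ hA (fun q i hq => hB ▸ (h.simB q i hq).1.of_frame hf (by simp))
    (by simp) (by simp) (by simp) (by simp)

theorem MemInv.of_frameB (h : MemInv G μ) {q i : ℕ} (hq : G.φ.pub = some (q, i))
    (hf : Frame (Set.range (HLoc.b i)) μ μ') (hφ : G'.φ = G.φ)
    (hB : Sim (HLoc.b i) HVal.b μ' G'.s.memB) (hA : G'.s.memA = G.s.memA) :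
    MemInv G' μ' := by
  refine h.of_frame hf hφ (hA ▸ h.simA.of_frame hf (by simp)) (fun q' i' hq' => ?_)
    (by simp) (by simp) (by simp) fun j ℓ hj => ?_
  · rw [hq] at hq'
    cases hq'
    exact hB
  · obtain ⟨ℓ', hℓ'⟩ := hj
    cases hℓ'
    rw [(hf (.inst i) (by simp)).1]
    exact (h.simB q i hq).2

/-- Operations in the address space of `A`. -/
theorem Inv.preserved_of_frameA {pt : Point A B F C} (h : Inv G μ P)
    (hf : Frame (Set.range HLoc.a) μ μ') (hG : G.Ext τ G') (hφ : G'.φ = G.φ) (hv : G'.Valid)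
    (hA : Sim HLoc.a HVal.a μ' G'.s.memA) (hB : G'.s.memB = G.s.memB)
    (hx : ThreadInv G' μ' τ (residual x)) (hown : owned (residual x) = none)
    (hp : ∀ k, x = .more k → Progress G G' τ pt k) : Preserved G P τ pt x μ' :=
  h.preserved_of_frame hf hG hφ hv (h.mem.of_frameA hf hφ hA hB) (by simp) (by simp) (by simp) hx
    (by simp [hown]) hp

/-- Operations in the published instance of `B`. -/
theorem Inv.preserved_of_frameB {pt : Point A B F C} (h : Inv G μ P) {q i : ℕ}
    (hq : G.φ.pub = some (q, i)) (hf : Frame (Set.range (HLoc.b i)) μ μ') (hG : G.Ext τ G')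
    (hφ : G'.φ = G.φ) (hv : G'.Valid) (hB : Sim (HLoc.b i) HVal.b μ' G'.s.memB)
    (hA : G'.s.memA = G.s.memA)
    (hx : ThreadInv G' μ' τ (residual x)) (hown : owned (residual x) = none)
    (hp : ∀ k, x = .more k → Progress G G' τ pt k) : Preserved G P τ pt x μ' := by
  refine h.preserved_of_frame hf hG hφ hv (h.mem.of_frameB hq hf hφ hB hA) (by simp) (by simp)
    (fun j ℓ τ' hτ hj hℓ => ?_) hx (by simp [hown]) hp
  obtain ⟨ℓ', hℓ'⟩ := hℓ
  cases hℓ'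
  obtain ⟨l, hl⟩ := h.private_of_owned hj
  exact hl.not_pub q hq

theorem Inv.inA (hAF : A.FreezeFree) (h : Inv G μ P) {m : M} {k : A.K}
    (hP : P τ = some (.inA m k)) (he : Exec (act (.inA m k)) μ x μ') :
    Preserved G P τ (.inA m k) x μ' := by
  have ht := h.thread τ
  rw [hP] at ht
  obtain ⟨y, ν, he', rfl, hS, hf⟩ := exec_onA h.mem he
  obtain ⟨G', hE, hφ, hv, rfl, hB, hy⟩ := h.valid.opA hAF ht.1 ht.2 he'
  rcases hy with ⟨rfl, hpub, hi, hr⟩ | ⟨k', rfl, hρ, hp, hr⟩ | ⟨r, rfl, hi⟩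
  · refine h.preserved_of_frameA hf hE hφ hv hS hB hi rfl ?_
    rintro k hk
    cases hk
    refine Or.inr (Or.inr ⟨hr, fun s v _ _ => ?_⟩)
    simp [weight, hφ, hpub]
  · refine h.preserved_of_frameA hf hE hφ hv hS hB ⟨hρ, hp⟩ rfl ?_
    rintro k hk
    cases hk
    exact Or.inl ⟨hr, fun s v => by simp [weight]⟩
  · exact h.preserved_of_frameA hf hE hφ hv hS hB hi rfl (by rintro k ⟨⟩)

theorem Inv.inB (h : Inv G μ P) {m : M} {i : ℕ} {k : B.K}
    (hP : P τ = some (.inB m i k)) (he : Exec (act (.inB m i k)) μ x μ') :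
    Preserved G P τ (.inB m i k) x μ' := by
  classical
  have ht := h.thread τ
  rw [hP] at ht
  obtain ⟨hc, ⟨q, hq⟩, hρ⟩ := ht
  obtain ⟨y, ν, he', rfl, hS, hf⟩ := exec_onB h.mem hq he
  have hstep : TransState.Step G.s ⟨G.s.memA, ν, G.s.converted,
      Function.update G.s.role τ (Role.afterB m y)⟩ := by
    have := TransState.Step.opB (μ := G.s.memA) (c := G.s.converted) hρ he'
    convert this
  have hv := h.valid.transStep (.single hstep) (by simp [hq]) rfl id
  refine h.preserved_of_frameB hq hf
    (.setRole id) rfl hv hS rfl ?_ ?_ ?_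
  · cases y with
    | more k' => exact ⟨hc, ⟨q, hq⟩, by simp [Role.afterB]⟩
    | done r => exact Or.inl (by simp [Role.afterB])
  · cases y <;> rfl
  · rintro k' hk'
    cases y with
    | done r => cases hk'
    | more k' =>
      cases hk'
      refine Or.inr (Or.inl ⟨?_, hc, .refl _, fun s v => by simp [weight]⟩)
      have hp : G.s.stateB.pool τ = some (m, k) := by simp [TransState.stateB, hρ, Role.toB]
      refine .op hp he' ?_
      convert Impl.Run.refl _ using 2
      · rfl
      funext τ'
      by_cases h : τ' = τ
      · subst h; simp [TransState.stateB, Role.afterB, Role.toB]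
      · simp [Function.update_of_ne h, TransState.stateB]

theorem Inv.freeze (h : Inv G μ P) {c : Option M} {p : ℕ} {a : A.L} {b : ℕ × B.L} {k : F.K}
    (hP : P τ = some (.freeze c p a b k)) (he : Exec (act (.freeze c p a b k)) μ x μ') :
    Preserved G P τ (.freeze c p a b k) x μ' := by
  classical
  have ht := h.thread τ
  rw [hP] at ht
  obtain ⟨i, b⟩ := b
  obtain ⟨rfl, rfl, hq, n, hρ⟩ := ht
  obtain ⟨y, ν, he', rfl, hS, hf⟩ := exec_onA h.mem he
  have hstep : TransState.Step G.s ⟨ν, G.s.memB, G.s.converted,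
      Function.update G.s.role τ (Role.afterFreeze (n + 1) y)⟩ := by
    have := TransState.Step.opFreeze (ν := G.s.memB) (c := G.s.converted) hρ he'
    convert this
  have hheap := he'.heap_eq_of_readsOrFreezes (F.readsOrFreezes k)
  cases y with
  | some k' =>
    have hv := h.valid.transStep (.single hstep) (by simp [hq]) hheap id
    refine h.preserved_of_frameA hf
      (.setRole id) rfl hv hS rfl
      ⟨rfl, rfl, hq, n + 1, by simp [Role.afterFreeze]⟩ rfl ?_
    rintro k hk
    cases hk
    refine Or.inr (Or.inr ⟨.refl _, fun s v hs _ => ?_⟩)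
    have : n + 1 ≤ s := hs (n + 1) k' (by simp [Role.afterFreeze])
    simp only [weight, stepsTaken, hρ, Function.update_self, Role.afterFreeze]
    omega
  | none =>
    have hstep' : TransState.Step ⟨ν, G.s.memB, G.s.converted,
        Function.update G.s.role τ (Role.afterFreeze (n + 1) none)⟩
        ⟨ν, G.s.memB, G.s.converted,
          Function.update G.s.role τ (.converting 0 (C.start A.root B.root))⟩ := by
      have := TransState.Step.callConvert (A := A) (B := B) (F := F) (C := C) (μ := ν)
        (ν := G.s.memB) (c := G.s.converted)
        (ρ := Function.update G.s.role τ (Role.afterFreeze (n + 1) none)) (τ := τ)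
        (by simp [Role.afterFreeze])
      rw [Function.update_idem] at this
      convert this
    have hv := h.valid.transStep (.tail (.single hstep) hstep') (by simp [hq]) hheap id
    refine h.preserved_of_frameA hf
      (.setRole id) rfl hv hS rfl
      ⟨rfl, hq, 0, by simp⟩ rfl ?_
    rintro k hk
    cases hk
    refine Or.inr (Or.inr ⟨.refl _, fun s v hs _ => ?_⟩)
    simp only [weight, stepsTaken, hρ, Function.update_self]
    omega

/-- An operation of `convert` decreases the weight, in whichever address space it takes place. -/
theorem weight_afterConvert {n : ℕ} {c : Option M} {p : ℕ} {b : ℕ × B.L} {k : C.K}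
    {y : Option C.K} {φ : Phase} {ρ ρ' : Role A B F C} (hρ : ρ = .converting n k)
    (hρ' : ρ' = Role.afterConvert (n + 1) y) {k' : Point A B F C}
    (hk' : afterConvert c p b y = .more k') {s v : ℕ}
    (hv : ∀ n k, ρ' = .converting n k → n ≤ v) :
    weight s v φ ρ' (some k') < weight s v φ ρ (some (.convert c p b k)) := by
  subst hρ hρ'
  cases y with
  | none =>
    cases hk'
    simp only [weight, stepsTaken]
    omega
  | some k'' =>
    cases hk'
    have : n + 1 ≤ v := hv (n + 1) k'' rfl
    simp only [weight, stepsTaken, Role.afterConvert]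
    omega

theorem threadInv_afterConvert {n : ℕ} {c : Option M} {p i : ℕ} {y : Option C.K}
    (hq : G.φ.pub = some (p, i)) (hc : y = none → G.s.converted)
    (hρ : G.s.role τ = Role.afterConvert (n + 1) y) :
    ThreadInv G μ τ (residual (afterConvert c p (i, B.root) y)) := by
  cases y with
  | none => exact ⟨Or.inl hρ, hc rfl, rfl, hq⟩
  | some k => exact ⟨rfl, hq, n + 1, hρ⟩

theorem owned_afterConvert {c : Option M} {p : ℕ} {b : ℕ × B.L} {y : Option C.K} :
    owned (residual (afterConvert c p b y : Cont A B F C)) = none := by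
  cases y <;> rfl

theorem Inv.convert (h : Inv G μ P) {c : Option M} {p : ℕ} {b : ℕ × B.L} {k : C.K}
    (hP : P τ = some (.convert c p b k)) (he : Exec (act (.convert c p b k)) μ x μ') :
    Preserved G P τ (.convert c p b k) x μ' := by
  classical
  have ht := h.thread τ
  rw [hP] at ht
  obtain ⟨i, b⟩ := b
  obtain ⟨rfl, hq, n, hρ⟩ := ht
  simp only [act] at he
  cases hk : C.act k with
  | readA ℓ κ =>
    rw [hk] at he
    obtain ⟨w, hw, rfl, rfl⟩ : ∃ w, G.s.memA.heap.get ℓ = some w ∧ μ' = μ ∧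
        x = afterConvert c p (i, B.root)
          (κ (if ℓ ∈ G.s.memA.frozen then .inl w else .inr w)) := by
      cases he with
      | casFrozen hv hℓ =>
        obtain ⟨w, hw, rfl⟩ := h.mem.simA.exists_get hv
        exact ⟨w, hw, rfl, by rw [if_pos ((h.mem.simA.frozen ℓ).1 hℓ)]⟩
      | casFail hv hℓ _ =>
        obtain ⟨w, hw, rfl⟩ := h.mem.simA.exists_get hv
        exact ⟨w, hw, rfl, by rw [if_neg fun h' => hℓ ((h.mem.simA.frozen ℓ).2 h')]⟩
      | casSuccess hv hℓ =>
        obtain ⟨w, hw, hw'⟩ := h.mem.simA.exists_get hv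
        cases hw'
    generalize hy : κ (if ℓ ∈ G.s.memA.frozen then .inl w else .inr w) = y
    have hstep : TransState.Step G.s ⟨G.s.memA, G.s.memB, G.s.converted ∨ y = none,
        Function.update G.s.role τ (Role.afterConvert (n + 1) y)⟩ := by
      have := TransState.Step.readConvert (ν := G.s.memB) (c := G.s.converted) hρ hk hw
        (x := y) (by rw [← hy])
      convert this
    have hv := h.valid.transStep (.single hstep) (by simp [hq]) rfl Or.inl
    exact h.preserved_of_frameA (Frame.refl _ _)
      (.setRole Or.inl) rfl hv
      h.mem.simA rfl (threadInv_afterConvert (n := n) hq Or.inr (by simp)) owned_afterConvert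
      fun k' hk' => Or.inr (Or.inr ⟨.refl _, fun s v _ hv =>
        weight_afterConvert (n := n) hρ (by simp) hk' hv⟩)
  | onB a =>
    rw [hk] at he
    obtain ⟨y, ν, he', rfl, hS, hf⟩ := exec_onB h.mem hq he
    have hstep : TransState.Step G.s ⟨G.s.memA, ν, G.s.converted ∨ y = none,
        Function.update G.s.role τ (Role.afterConvert (n + 1) y)⟩ := by
      have := TransState.Step.opConvert (μ := G.s.memA) (c := G.s.converted) hρ hk he'
      convert this
    have hv := h.valid.transStep (.single hstep) (by simp [hq]) rfl Or.inl
    exact h.preserved_of_frameB hq hf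
      (.setRole Or.inl) rfl hv
      hS rfl (threadInv_afterConvert (n := n) hq Or.inr (by simp)) owned_afterConvert
      fun k' hk' => Or.inr (Or.inr ⟨.refl _, fun s v _ hv =>
        weight_afterConvert (n := n) hρ (by simp) hk' hv⟩)

theorem Inv.exec (hAF : A.FreezeFree) (h : Inv G μ P) {pt : Point A B F C}
    (hP : P τ = some pt) (he : Exec (act pt) μ x μ') : Preserved G P τ pt x μ' := by
  cases pt with
  | rwRoot m => exact h.rwRoot hP he
  | rwCell m p => exact h.rwCell hP he
  | inA m k => exact h.inA hAF hP he
  | inB m i k => exact h.inB hP he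
  | trRoot c => exact h.trRoot hP he
  | trCell c p => exact h.trCell hP he
  | newInst c p a => exact h.newInst hP he
  | newBinding c p a i ℓ v rest => exact h.newBinding hP he
  | newAB c p a b => exact h.newAB hP he
  | casAB c p a b q => exact h.casAB hP he
  | freeze c p a b k => exact h.freeze hP he
  | convert c p b k => exact h.convert hP he
  | newB c p b => exact h.newB hP he
  | casB c p q => exact h.casB hP he
  | noop c => exact h.noop hP he
  | stuck => cases he

end Ops

/-! ### Reachable states -/

/-- The program points of the threads. -/
def points (P : T → Option (Option M × Point A B F C)) (τ : T) : Option (Point A B F C) :=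
  (P τ).map Prod.snd

open Classical in
theorem points_update (P : T → Option (Option M × Point A B F C)) (τ : T)
    (o : Option (Option M × Point A B F C)) :
    points (Function.update P τ o) = Function.update (points P) τ (o.map Prod.snd) := by
  funext τ'
  by_cases h : τ' = τ
  · subst h; simp [points]
  · simp [points, Function.update_of_ne h]

theorem points_eq_none {P : T → Option (Option M × Point A B F C)} {τ : T} (h : P τ = none) :
    points P τ = none := by
  simp [points, h]

theorem points_eq_some {P : T → Option (Option M × Point A B F C)} {τ : T} {m : Option M}
    {k : Point A B F C} (h : P τ = some (m, k)) : points P τ = some k := by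
  simp [points, h]

open Classical in
theorem Inv.points_update {G : Ghost A B F C} {μ : Mem (Loc A B) (Val A B)}
    {P : T → Option (Option M × Point A B F C)} {τ : T} {o : Option (Option M × Point A B F C)}
    (h : Inv G μ (Function.update (points P) τ (o.map Prod.snd))) :
    Inv G μ (points (Function.update P τ o)) := by
  rwa [Hybrid.points_update]

/-- `σ` satisfies the invariant together with `G`. -/
abbrev StateInv (G : Ghost A B F C) (σ : (impl A B F C).State T) : Prop :=
  Inv G σ.mem (points σ.pool)

theorem stateInv_init (A B : DataStructure T M R) (F : FreezeFun A) (C : ConvertFun A B) :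
    StateInv ⟨A.initState T, .start B F C (A.initState T), .A⟩ ((impl A B F C).initState T) := by
  have hget : ∀ (ℓ : Loc A B) (w : Val A B), (Heap.ofList (init A B)).get ℓ = some w ↔
      (ℓ, w) ∈ init A B := Heap.ofList_get_eq_some (init_nodup A B)
  have hfr : ((impl A B F C).initState T).mem.frozen = ∅ := rfl
  have hnone : ∀ ℓ : Loc A B, (∀ w, (ℓ, w) ∉ init A B) →
      ((impl A B F C).initState T).mem.heap.get ℓ = none := fun ℓ h =>
    Option.eq_none_iff_forall_ne_some.2 fun w hw => h w ((hget ℓ w).1 hw)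
  refine ⟨⟨A.isState_init, ⟨_, A.isState_init, rfl, .refl⟩, rfl, fun _ => rfl,
      by simp [Phase.cellB]⟩, ⟨⟨fun ℓ => Option.ext fun w => ?_, fun ℓ => Iff.rfl⟩,
      by simp [Phase.pub], ?_, (by rw [hfr]; exact Set.notMem_empty _), fun p st hc => ?_,
      fun i _ ℓ => ⟨hnone _ ?_, by rw [hfr]; exact Set.notMem_empty _⟩⟩,
    fun τ => Or.inr ⟨rfl, rfl⟩, fun τ τ' i h => by cases h⟩
  · rw [Option.map_eq_some_iff]
    refine (hget (.a ℓ) w).trans ?_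
    simp only [TransState.start, Impl.initState, Impl.initMem,
      Heap.ofList_get_eq_some A.init_nodup]
    simp [init, eq_comm]
  · exact (hget _ _).2 (by simp [init, Phase.rootCell])
  · cases hc with
    | a => exact (hget _ _).2 (by simp [init])
    | ab h => simp [Phase.pub] at h
    | b h => simp [Phase.pub] at h
  · simp [init]

open Classical in
theorem Inv.call {G : Ghost A B F C} {μ : Mem (Loc A B) (Val A B)}
    {P : T → Option (Point A B F C)} (h : Inv G μ P) {τ : T} (hP : P τ = none) (m : Option M) :
    Inv G μ (Function.update P τ (some (m.elim (.trRoot none) .rwRoot))) := by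
  have hi := h.thread τ
  rw [hP] at hi
  refine h.update (.refl G τ) h.valid h.mem (fun _ _ => id) (fun _ _ _ _ _ => id) ?_ ?_
  · cases m <;> exact hi
  · cases m <;> simp [owned]

theorem exists_stateInv (hAF : A.FreezeFree) {σ : (impl A B F C).State T}
    (h : (impl A B F C).Reachable T σ) : ∃ G, StateInv G σ := by
  induction h with
  | init => exact ⟨_, stateInv_init A B F C⟩
  | step _ hs ih =>
    obtain ⟨G, hG⟩ := ih
    cases hs with
    | @call μ P t tr m hP =>
      exact ⟨G, .points_update (o := some _) (hG.call (points_eq_none hP) m)⟩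
    | @op μ μ' P t tr m k k' hP he =>
      obtain ⟨G', -, hG', -⟩ := hG.exec hAF (points_eq_some hP) he
      exact ⟨G', .points_update (o := some _) hG'⟩
    | @finish μ μ' P t tr m k r hP he =>
      obtain ⟨G', -, hG', -⟩ := hG.exec hAF (points_eq_some hP) he
      exact ⟨G', .points_update (o := none) hG'⟩

/-! ### Counting the operations of an execution that completes no method -/

section Counting

variable {G : Ghost A B F C} {μ : Mem (Loc A B) (Val A B)} {P : T → Option (Point A B F C)}

theorem Inv.size_memA_le (h : Inv G μ P) : G.s.memA.heap.size ≤ μ.heap.size :=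
  h.mem.simA.size_le fun _ _ => HLoc.a.inj

theorem Inv.size_memB_le (h : Inv G μ P) (hc : G.s.converted) :
    G.s.memB.heap.size ≤ μ.heap.size := by
  cases hp : G.φ.pub with
  | some x => exact (h.mem.simB x.1 x.2 hp).1.size_le fun _ _ h => (HLoc.b.inj h).2
  | none =>
    have hφ : G.φ = .A := by cases hφ : G.φ <;> simp_all [Phase.pub]
    rw [h.valid.start hφ] at hc
    exact hc.elim

/-- The total weight of the threads. -/
def totalWeight [Fintype T] (s v : ℕ) (G : Ghost A B F C) (P : T → Option (Point A B F C)) : ℕ :=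
  ∑ τ, weight s v G.φ (G.s.role τ) (P τ)

theorem Inv.totalWeight_le [Fintype T] (h : Inv G μ P) (s v : ℕ) :
    totalWeight s v G P ≤ Fintype.card T * (s + v + 13 + B.init.length) := by
  refine (Finset.sum_le_card_nsmul _ _ (s + v + 13 + B.init.length) fun τ _ => ?_).trans_eq
    (by simp)
  refine weight_le _ _ _ _ _ fun c p a i ℓ w rest hpt => ?_
  have ht := h.thread τ
  rw [hpt] at ht
  obtain ⟨-, -, -, dn, hdn, -⟩ := ht
  simp [hdn]
  omega

open Classical in
theorem totalWeight_update_le [Fintype T] {G' : Ghost A B F C} {τ : T}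
    {pt : Option (Point A B F C)} (hG : G.Ext τ G') {s v : ℕ}
    (h : weight s v G'.φ (G'.s.role τ) pt ≤ weight s v G.φ (G.s.role τ) (P τ)) :
    totalWeight s v G' (Function.update P τ pt) ≤ totalWeight s v G P := by
  refine Finset.sum_le_sum fun τ' _ => ?_
  by_cases hτ : τ' = τ
  · subst hτ; simpa using h
  · rw [hG.role τ' hτ, Function.update_of_ne hτ]
    exact weight_mono hG.phase s v _ _

open Classical in
theorem totalWeight_update_lt [Fintype T] {G' : Ghost A B F C} {τ : T}
    {pt : Option (Point A B F C)} (hG : G.Ext τ G') {s v : ℕ}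
    (h : weight s v G'.φ (G'.s.role τ) pt < weight s v G.φ (G.s.role τ) (P τ)) :
    totalWeight s v G' (Function.update P τ pt) < totalWeight s v G P := by
  refine Finset.sum_lt_sum (fun τ' _ => ?_) ⟨τ, Finset.mem_univ _, by simpa using h⟩
  by_cases hτ : τ' = τ
  · subst hτ; simpa using h.le
  · rw [hG.role τ' hτ, Function.update_of_ne hτ]
    exact weight_mono hG.phase s v _ _

/-- The quantities that bound how long an execution without completions can go on from a state
with the memory `μ` and the threads at the points `P`: the heap has size at most `z`; at most `r`
operations of `B` come before the next other operation; and the remaining operations of `A`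
(at most `a`) and the total weight sum up to at most `n`.  The heap of `A` cannot grow beyond
`h`, which is what makes the weights meaningful. -/
def Budget [Fintype T] (A B : DataStructure T M R) (F : FreezeFun A) (C : ConvertFun A B)
    (s v h n r z : ℕ) (μ : Mem (Loc A B) (Val A B)) (P : T → Option (Point A B F C)) : Prop :=
  ∃ G : Ghost A B F C, Inv G μ P ∧ μ.heap.size ≤ z ∧ (G.s.converted → B.Bounded G.s.stateB r) ∧
    ∃ a, A.Bounded G.α a ∧ G.s.memA.heap.size + a ≤ h ∧ a + totalWeight s v G P ≤ n

open Classical in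
theorem Budget.points_update [Fintype T] {s v h n r z : ℕ}
    {P : T → Option (Option M × Point A B F C)} {τ : T} {o : Option (Option M × Point A B F C)}
    (hb : Budget A B F C s v h n r z μ (Function.update (points P) τ (o.map Prod.snd))) :
    Budget A B F C s v h n r z μ (points (Function.update P τ o)) := by
  rwa [Hybrid.points_update]

theorem Ghost.Valid.size_memA (h : G.Valid) : G.s.memA.heap.size = G.α.mem.heap.size := by
  rw [h.memA]

open Classical in
theorem Budget.call [Fintype T] {s v h n r z : ℕ} (hb : Budget A B F C s v h n r z μ P) {τ : T}
    (hP : P τ = none) (m : Option M) :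
    Budget A B F C s v h n r z μ
      (Function.update P τ (some (m.elim (.trRoot none) .rwRoot))) := by
  obtain ⟨G, hG, hz, hB, a, ha, hh, hn⟩ := hb
  refine ⟨G, hG.call hP m, hz, hB, a, ha, hh, le_trans (Nat.add_le_add_left ?_ a) hn⟩
  refine totalWeight_update_le (.refl G τ) ?_
  rw [hP]
  exact weight_le _ _ _ _ _ (by cases m <;> simp)

open Classical in
/-- Every operation that completes no method uses up some budget.  An operation of `B` leaves `n`
alone and decreases `r`.  Any other operation decreases `n`; as it may change the target of
`convert`, the lock-freedom of `B` has to be invoked afresh. -/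
theorem Budget.exec [Fintype T] (hAF : A.FreezeFree) (hCB : ConvertYieldsState F C)
    {s v h n r z : ℕ} {g : ℕ → ℕ}
    (hs : ∀ t : TransState A B F C, t.Occurs → t.memA.heap.size ≤ h →
      ∀ τ n k, t.role τ = .freezing n k → n ≤ s)
    (hv : ∀ t : TransState A B F C, t.Occurs → t.memA.heap.size ≤ h →
      ∀ τ n k, t.role τ = .converting n k → n ≤ v)
    (hg : ∀ σ : B.State T, B.IsState σ → ∀ z, σ.mem.heap.size ≤ z → B.Bounded σ (g z))
    (hb : Budget A B F C s v h n r z μ P) {τ : T} {pt pt' : Point A B F C}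
    {μ' : Mem (Loc A B) (Val A B)} (hP : P τ = some pt) (he : Exec (act pt) μ (.more pt') μ') :
    (∃ r', r = r' + 1 ∧
        Budget A B F C s v h n r' (z + 1) μ' (Function.update P τ (some pt'))) ∨
      ∃ n', n = n' + 1 ∧
        Budget A B F C s v h n' (g (z + 1)) (z + 1) μ' (Function.update P τ (some pt')) := by
  obtain ⟨G, hG, hz, hB, a, ha, hh, hn⟩ := hb
  have hz' : μ'.heap.size ≤ z + 1 := he.size_le.trans (by omega)
  obtain ⟨G', hE, hG', hprog⟩ := hG.exec hAF hP he
  have hsA := hG.valid.size_memA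
  have hsA' := hG'.valid.size_memA
  have hB' : G'.s.converted → B.Bounded G'.s.stateB (g (z + 1)) := fun hc =>
    hg _ (hCB _ hG'.valid.occurs hc) _ ((hG'.size_memB_le hc).trans hz')
  rcases hprog pt' rfl with ⟨hr, hw⟩ | ⟨hrB, hc, hr, hw⟩ | ⟨hr, hw⟩
  · have hw := totalWeight_update_le hE (hP ▸ hw s v)
    obtain ⟨h1, ha'⟩ := ha.of_run hr
    have hsz := hr.size_le
    refine Or.inr ⟨n - 1, by omega, G', hG', hz', hB', a - 1, ha', by omega, ?_⟩
    simp only [residual] at *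
    omega
  · have hw := totalWeight_update_le hE (hP ▸ hw s v)
    obtain ⟨-, ha'⟩ := ha.of_run hr
    obtain ⟨h1, hB''⟩ := (hB hc).of_run hrB
    have hsz := hr.size_le
    exact Or.inl ⟨r - 1, by omega, G', hG', hz', fun _ => hB'', a, ha', by omega,
      (Nat.add_le_add_left hw a).trans hn⟩
  · obtain ⟨-, ha'⟩ := ha.of_run hr
    have hsz := hr.size_le
    have hle : G'.s.memA.heap.size ≤ h := by omega
    have hw := totalWeight_update_lt hE (hP ▸ hw s v (hs _ hG'.valid.occurs hle τ)
      (hv _ hG'.valid.occurs hle τ))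
    refine Or.inr ⟨n - 1, by omega, G', hG', hz', hB', a, ha', by omega, ?_⟩
    simp only [residual] at *
    omega

/-- The length of an execution in which phases of consecutive operations of `B` alternate with `n`
other operations: the current phase has length at most `r`, and a phase that begins with a heap of
size `z` has length at most `g z`. -/
def bound (g : ℕ → ℕ) : ℕ → ℕ → ℕ → ℕ
  | 0, r, _ => r
  | n + 1, r, z => r + 1 + bound g n (g (z + r + 1)) (z + r + 1)

theorem bound_mono {g : ℕ → ℕ} (hg : Monotone g) (n : ℕ) {r r' z z' : ℕ} (hr : r ≤ r')
    (hz : z ≤ z') : bound g n r z ≤ bound g n r' z' := by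
  induction n generalizing r r' z z' with
  | zero => exact hr
  | succ n ih =>
    have := ih (hg (show z + r + 1 ≤ z' + r' + 1 by omega)) (show z + r + 1 ≤ z' + r' + 1 by omega)
    simp only [bound]
    omega

theorem bound_succ_right {g : ℕ → ℕ} (n r z : ℕ) :
    bound g n r (z + 1) + 1 = bound g n (r + 1) z := by
  cases n with
  | zero => rfl
  | succ n =>
    simp only [bound, show z + 1 + r + 1 = z + (r + 1) + 1 by omega]
    omega

theorem Budget.run_le [Fintype T] (hAF : A.FreezeFree) (hCB : ConvertYieldsState F C)
    {s v h : ℕ} {g : ℕ → ℕ}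
    (hs : ∀ t : TransState A B F C, t.Occurs → t.memA.heap.size ≤ h →
      ∀ τ n k, t.role τ = .freezing n k → n ≤ s)
    (hv : ∀ t : TransState A B F C, t.Occurs → t.memA.heap.size ≤ h →
      ∀ τ n k, t.role τ = .converting n k → n ≤ v)
    (hmono : Monotone g)
    (hg : ∀ σ : B.State T, B.IsState σ → ∀ z, σ.mem.heap.size ≤ z → B.Bounded σ (g z))
    {N : ℕ} {σ σ' : (impl A B F C).State T} (hr : (impl A B F C).Run N σ σ') {n r z : ℕ}
    (hb : Budget A B F C s v h n r z σ.mem (points σ.pool)) : N ≤ bound g n r z := by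
  induction hr generalizing n r z with
  | refl => exact Nat.zero_le _
  | call m hm _ ih =>
    exact ih (.points_update (o := some _) (hb.call (points_eq_none hm) m))
  | op hm he _ ih =>
    rcases hb.exec hAF hCB hs hv hg (points_eq_some hm) he with
      ⟨r', rfl, hb'⟩ | ⟨n', rfl, hb'⟩
    · rw [← bound_succ_right]
      exact Nat.succ_le_succ (ih (.points_update (o := some _) hb'))
    · have h1 := ih (.points_update (o := some _) hb')
      have h2 := bound_mono hmono n' (hmono (show z + 1 ≤ z + r + 1 by omega))
        (show z + 1 ≤ z + r + 1 by omega)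
      simp only [bound]
      omega

end Counting

end Hybrid

theorem mainTheorem1 {T M R : Type} [Finite T] (A B : DataStructure T M R)
    (F : FreezeFun A) (C : ConvertFun A B)
    (hA : A.LockFree) (hB : B.LockFree) (hAF : A.FreezeFree)
    (hF : FreezeTimeBounded F C) (hC : ConvertTimeBounded F C) (hCB : ConvertYieldsState F C) :
    (hybrid A B F C).LockFree := by
  have := Fintype.ofFinite T
  cases isEmpty_or_nonempty T with
  | inl hT => exact ⟨fun _ => 0, fun _ _ π => (hT.false (π 0)).elim⟩
  | inr hT =>
    obtain ⟨gA, hgA, hAb⟩ := hA.exists_bounded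
    obtain ⟨gB, hgB, hBb⟩ := hB.exists_bounded
    obtain ⟨fF, hfF⟩ := hF
    obtain ⟨fC, hfC⟩ := hC
    obtain ⟨gF, hgF, hFb⟩ := exists_monotone_ge fF
    obtain ⟨gC, hgC, hCb⟩ := exists_monotone_ge fC
    -- `z + gA z` bounds the heap of `A` throughout an execution without completions
    refine ⟨fun z => Hybrid.bound gB (gA z + Fintype.card T *
      (gF (z + gA z) + gC (z + gA z) + 13 + B.init.length)) (gB z) z + 1,
      fun c hc π c' hexec htime => ?_⟩
    rcases Impl.exec_trace_or_run hexec with hlt | ⟨-, N, hN, hrun⟩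
    · exact hlt
    · exfalso
      obtain ⟨G, hG⟩ := Hybrid.exists_stateInv hAF hc
      have hle := Hybrid.Budget.run_le hAF hCB
        (s := gF (c.state.mem.heap.size + gA c.state.mem.heap.size))
        (v := gC (c.state.mem.heap.size + gA c.state.mem.heap.size))
        (h := c.state.mem.heap.size + gA c.state.mem.heap.size)
        (fun t ht hsz τ n k hk => (hfF t ht τ n k hk).trans ((hFb _).trans (hgF hsz)))
        (fun t ht hsz τ n k hk => (hfC t ht τ n k hk).trans ((hCb _).trans (hgC hsz)))
        hgB hBb hrun
        ⟨G, hG, le_rfl, fun hconv => hBb _ (hCB _ hG.valid.occurs hconv) _ (hG.size_memB_le hconv),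
          gA c.state.mem.heap.size,
          hAb _ hG.valid.isState _ (hG.valid.size_memA ▸ hG.size_memA_le),
          Nat.add_le_add_right hG.size_memA_le _,
          Nat.add_le_add_left (hG.totalWeight_le _ _) _⟩
      exact (Nat.lt_succ_of_le hle).ne (Nat.add_left_cancel (hN.symm.trans htime))
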